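/- **Proposition (Finsler structure of symmetric Hilbert geometries).** Let $V$ be a finite-dimensional unital Euclidean Jordan algebra, that is, a finite-dimensional real vector space with a commutative bilinear product $\bullet$ with unit $u$ satisfying $x^2\bullet(y\bullet x)=(x^2\bullet y)\bullet x$, and an inner product with $(x\bullet y\,|\,z)=(y\,|\,x\bullet z)$ for all $x,y,z\in V$. Each $x\in V$ has a spectral decomposition $x=\sum_{i=1}^r\lambda_ip_i$, where $p_1,\dots,p_r$ is a Jordan frame (mutually orthogonal primitive idempotents with sum $u$) and $r$ is the rank of $V$. Put $\mathrm{tr}(x)=\sum_i\lambda_i$, $\phi(x)=\frac1r\mathrm{tr}(x)$ and, if all $\lambda_i>0$, $x^s=\sum_i\lambda_i^sp_i$ for $s\in\mathbb{R}$. Let $U_xy=2x\bullet(x\bullet y)-x^2\bullet y$. Let $V_+=\{x^2: x\in V\}$ be the cone of squares, write $x\le y$ if $y-x\in V_+$, and let $$\Omega_V=\{x\in\mathrm{int}\,V_+ : \phi(x)=1\}.$$ For $x\in V$ and $y\in\mathrm{int}\,V_+$ let $$M(x/y)=\inf\{\beta\in\mathbb{R}: x\le\beta y\},\quad m(x/y)=\sup\{\alpha\in\mathbb{R}:\alpha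 y\le x\},\quad |x|_y=M(x/y)-m(x/y),$$ and for $x,y\in\mathrm{int}\,V_+$ let $d_H(x,y)=\log\bigl(M(x/y)/m(x/y)\bigr)$. Then for all $x,y\in\Omega_V$: 1. for every continuous, piecewise $C^1$ path $\gamma\colon[0,1]\to\Omega_V$ with $\gamma(0)=x$ and $\gamma(1)=y$ the function $t\mapsto|\gamma'(t)|_{\gamma(t)}$ (defined for all but finitely many $t$) is integrable on $[0,1]$, and $$d_H(x,y)=\inf_\gamma L(\gamma),\qquad L(\gamma)=\int_0^1|\gamma'(t)|_{\gamma(t)}\,dt,$$ where the infimum is taken over all such paths $\gamma$; 2. the infimum is attained: with $\sigma(t)=U_{x^{1/2}}\bigl((U_{x^{-1/2}}y)^t\bigr)$, the normalized path $\mu(t)=\sigma(t)/\phi(\sigma(t))$, $0\le t\le1$, is a piecewise $C^1$ path in $\Omega_V$ from $x$ to $y$ with $L(\mu)=d_H(x,y)$. -/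

import Mathlib

/-- A (finite-dimensional, unital) Euclidean Jordan algebra: a finite-dimensional real vector space
with a commutative bilinear product `*`, a unit `1`, the Jordan identity (`IsCommJordan`), and an
inner product for which every multiplication operator `L_x y = x * y` is self-adjoint.  The norm is
the one of that inner product; it only serves to fix the topology of the finite-dimensional
space. -/
class EuclideanJordanAlgebra (V : Type*) extends
    NormedAddCommGroup V, InnerProductSpace ℝ V, NonAssocCommRing V, IsCommJordan V where
  finiteDimensional : FiniteDimensional ℝ V
  smul_mul : ∀ (c : ℝ) (x y : V), (c • x) * y = c • (x * y)
  inner_mul : ∀ x y z : V, Inner.inner ℝ (x * y) z = Inner.inner ℝ y (x * z)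

namespace EuclideanJordanAlgebra

section Defs

variable {V : Type*} [EuclideanJordanAlgebra V]

/-- A primitive idempotent: a nonzero idempotent that is not the sum of two nonzero
idempotents. -/
def IsPrimitiveIdempotent (p : V) : Prop :=
  p * p = p ∧ p ≠ 0 ∧
    ¬ ∃ a b : V, a * a = a ∧ b * b = b ∧ a ≠ 0 ∧ b ≠ 0 ∧ p = a + b

/-- A Jordan frame: mutually orthogonal primitive idempotents that sum to the unit. -/
structure IsJordanFrame {n : ℕ} (p : Fin n → V) : Prop where
  primitive : ∀ i, IsPrimitiveIdempotent (p i)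
  orthogonal : ∀ i j, i ≠ j → p i * p j = 0
  sum_eq_one : ∑ i, p i = 1

variable (V) in
/-- The rank of `V`: the (maximal) number of elements of a Jordan frame. -/
noncomputable def rank : ℕ :=
  sSup {n : ℕ | ∃ p : Fin n → V, IsJordanFrame p}

/-- A spectral decomposition `x = ∑ i, lam i • p i` along a Jordan frame `p`; the numbers `lam i`
are the eigenvalues of `x`, counted with multiplicity. -/
structure SpectralDecomposition (x : V) where
  /-- the number of elements of the frame -/
  n : ℕ
  /-- the eigenvalues -/
  lam : Fin n → ℝ
  /-- the frame -/
  p : Fin n → V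
  isJordanFrame : IsJordanFrame p
  eq_sum : x = ∑ i, lam i • p i

open Classical in
/-- The trace of `x`: the sum of its eigenvalues with multiplicity.  (A spectral decomposition
always exists, and the value does not depend on the chosen one.) -/
noncomputable def trace (x : V) : ℝ :=
  if h : Nonempty (SpectralDecomposition x) then ∑ i, h.some.lam i else 0

open Classical in
/-- The real power `x ^ s = ∑ i, (lam i) ^ s • p i`, where `x = ∑ i, lam i • p i` is a spectral
decomposition.  It is used only for `x` in the interior of the cone of squares, whose eigenvalues
are positive.  (A spectral decomposition always exists, and the value does not depend on the
chosen one.) -/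
noncomputable def power (x : V) (s : ℝ) : V :=
  if h : Nonempty (SpectralDecomposition x) then ∑ i, (h.some.lam i) ^ s • h.some.p i else 0

/-- The quadratic representation `U_x y = 2 x (x y) - x² y`. -/
def quadRep (x y : V) : V := (2 : ℝ) • (x * (x * y)) - (x * x) * y

variable (V) in
/-- The cone of squares `V₊`.  It induces the order `x ≤ y ↔ y - x ∈ V₊`. -/
def cone : Set V := {z | ∃ x : V, z = x * x}

/-- `M(x/y) = inf {β : x ≤ β y}`. -/
noncomputable def upperM (x y : V) : ℝ := sInf {β : ℝ | β • y - x ∈ cone V}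

/-- `m(x/y) = sup {α : α y ≤ x}`. -/
noncomputable def lowerM (x y : V) : ℝ := sSup {α : ℝ | x - α • y ∈ cone V}

/-- The seminorm `|x|_w = M(x/w) - m(x/w)`. -/
noncomputable def finslerNorm (w x : V) : ℝ := upperM x w - lowerM x w

/-- Birkhoff's version of the Hilbert distance, `d_H(x,y) = log (M(x/y) / m(x/y))`, for `x`, `y`
in the interior of the cone. -/
noncomputable def hilbertDist (x y : V) : ℝ := Real.log (upperM x y / lowerM x y)

/-- The state `φ(x) = tr(x) / r`, with `r` the rank of `V`. -/
noncomputable def normTrace (x : V) : ℝ := (1 / (rank V : ℝ)) * trace x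

variable (V) in
/-- The domain `Ω_V` of the symmetric Hilbert geometry. -/
def domain : Set V := {x | x ∈ interior (cone V) ∧ normTrace x = 1}

/-- `γ` restricted to `[0,1]` is a continuous piecewise `C¹` path in `Ω_V` from `x` to `y`. -/
def IsPath (x y : V) (γ : ℝ → V) : Prop :=
  γ 0 = x ∧ γ 1 = y ∧ (∀ t ∈ Set.Icc (0 : ℝ) 1, γ t ∈ domain V) ∧
    ContinuousOn γ (Set.Icc 0 1) ∧
    ∃ (k : ℕ) (t : ℕ → ℝ), t 0 = 0 ∧ t k = 1 ∧ (∀ i < k, t i < t (i + 1)) ∧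
      ∀ i < k, ContDiffOn ℝ 1 γ (Set.Icc (t i) (t (i + 1)))

/-- The speed `|γ'(t)|_{γ(t)}`.  (For a piecewise `C¹` path the derivative exists at all but
finitely many points of `[0,1]`.) -/
noncomputable def speed (γ : ℝ → V) (t : ℝ) : ℝ := finslerNorm (γ t) (deriv γ t)

/-- The length `L(γ) = ∫₀¹ |γ'(t)|_{γ(t)} dt`. -/
noncomputable def length (γ : ℝ → V) : ℝ := ∫ t in (0 : ℝ)..1, speed γ t

/-- `σ(t) = U_{x^{1/2}} ((U_{x^{-1/2}} y)^t)`. -/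
noncomputable def sigmaPath (x y : V) (t : ℝ) : V :=
  quadRep (power x (1 / 2)) (power (quadRep (power x (-(1 / 2))) y) t)

/-- The rescaled path `t ↦ σ(t) / φ(σ(t))`. -/
noncomputable def normalizedPath (x y : V) (t : ℝ) : V :=
  (normTrace (sigmaPath x y t))⁻¹ • sigmaPath x y t

end Defs

end EuclideanJordanAlgebra

namespace EuclideanJordanAlgebra

attribute [local instance] EuclideanJordanAlgebra.finiteDimensional

/-! ### Linearized Jordan identity, Peirce relations, power associativity -/

section JordanIdentities

variable {V : Type*} [EuclideanJordanAlgebra V]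

/-! Lower bound. The cone is self-dual, so `M(x/y)` and `m(x/y)` are values of `⟨x,e⟩ / ⟨y,e⟩` at
nonzero idempotents `e = p` and `e = q`. Hence `d_H(x,y)` is the increment of `log ⟨γ,q⟩ - log
⟨γ,p⟩` along any path `γ` from `x` to `y`. The derivative of this function is at most `M(γ'/γ) -
m(γ'/γ)`, because each `⟨γ',e⟩ / ⟨γ,e⟩` lies between `m(γ'/γ)` and `M(γ'/γ)`; then integrate
(`hilbertDist_le_length`).

Attainment. `U_a` with `a` positive is an automorphism of the cone, so it preserves `M` and `m`. It
therefore suffices to look at `z^t` for `z = U_{x^{-1/2}} y`, where position and velocity are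
diagonal in one Jordan frame: the speed is the constant `log λ_max - log λ_min`, which is
`d_H(1,z)`. Normalizing a path adds to its velocity a multiple of its position, which shifts `M` and
`m` equally and leaves the speed unchanged.

The algebraic input is built from the Jordan identity: the spectral theorem
(`nonempty_spectralDecomposition`), self-duality (`mem_cone_iff_inner`), linearity of the trace
(`exists_linearMap_primitive_eq_one`), and positivity and invertibility of `U_a`
(`quadRepLin_sum_aux`). The last avoids Peirce decompositions of the space: changing one eigenvalue
of `a` multiplies `U_a` by some `exp(s L_p)`, a limit of powers of positive resolvents. -/

theorem smul_mul' (c : ℝ) (x y : V) : (c • x) * y = c • (x * y) := smul_mul c x y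

theorem mul_smul' (c : ℝ) (x y : V) : x * (c • y) = c • (x * y) := by
  rw [mul_comm, smul_mul, mul_comm]

variable (V) in
/-- Multiplication as a bilinear map; `L V x` is the multiplication operator `L_x`. -/
noncomputable def L : V →ₗ[ℝ] V →ₗ[ℝ] V :=
  LinearMap.mk₂ ℝ (fun x y => x * y) add_mul smul_mul' mul_add mul_smul'

@[simp] theorem L_apply (x y : V) : L V x y = x * y := rfl

theorem L_one : L V 1 = 1 := by
  ext y
  simp

theorem isSymmetric_L (x : V) : (L V x).IsSymmetric := fun y z => inner_mul x y z

theorem lie_mul_add_lie_mul_add_lie_mul (a b c z : V) :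
    a * ((b * c) * z) - (b * c) * (a * z) + (b * ((c * a) * z) - (c * a) * (b * z)) +
      (c * ((a * b) * z) - (a * b) * (c * z)) = 0 := by
  have h : 2 • (a * ((b * c) * z) - (b * c) * (a * z) + (b * ((c * a) * z) - (c * a) * (b * z)) +
      (c * ((a * b) * z) - (a * b) * (c * z))) = 0 :=
    DFunLike.congr_fun (two_nsmul_lie_lmul_lmul_add_add_eq_zero a b c) z
  linear_combination (norm := module) (1 / 2 : ℝ) • h

/-- The linearized Jordan identity. -/
theorem sq_mul_mul (x y z : V) :
    (x * x * y) * z =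
      (2 : ℝ) • ((x * y) * (x * z)) + (x * x) * (y * z) - (2 : ℝ) • (x * (y * (x * z))) := by
  have h := lie_mul_add_lie_mul_add_lie_mul x x z y
  rw [mul_comm z x, mul_comm z (x * x * y), mul_comm z y, mul_comm (x * z) (x * y),
    mul_comm (x * z) y] at h
  linear_combination (norm := module) h

theorem L_sq_mul (x y : V) :
    L V (x * x * y) =
      (2 : ℝ) • (L V (x * y) * L V x) + L V (x * x) * L V y - (2 : ℝ) • (L V x * L V y * L V x) := by
  ext z
  simpa using sq_mul_mul x y z

theorem commute_L_sq (x : V) : Commute (L V (x * x)) (L V x) := by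
  ext z
  have h := lie_mul_add_lie_mul_add_lie_mul x x x z
  simp only [Module.End.mul_apply, L_apply]
  linear_combination (norm := module) -(1 / 3 : ℝ) • h

/-! ### The Peirce relations of an idempotent -/

variable {p c : V}

theorem commute_L_of_mul_eq_zero (hp : p * p = p) (hc : p * c = 0) :
    Commute (L V p) (L V c) := by
  ext z
  have h := lie_mul_add_lie_mul_add_lie_mul p p c z
  rw [mul_comm c p, hc, hp] at h
  simp only [Module.End.mul_apply, L_apply]
  simp only [zero_mul, mul_zero, sub_self, zero_add] at h
  linear_combination (norm := module) -h

/-- This confines the spectrum of `L_p` to the roots `0`, `1/2`, `1` of `2λ³ - 3λ² + λ`. -/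
theorem L_idempotent_cubic (hp : p * p = p) :
    (2 : ℝ) • (L V p * L V p * L V p) = (3 : ℝ) • (L V p * L V p) - L V p := by
  have h := L_sq_mul p p
  simp only [hp] at h
  linear_combination (norm := module) h

theorem mul_mul_idempotent_eq_zero (hp : p * p = p) (hc : p * c = 0) : p * (c * c) = 0 := by
  have h := DFunLike.congr_fun (commute_L_of_mul_eq_zero hp hc).eq c
  simpa [hc] using h

/-- Equivalently, the range of `L_p L_c` lies in the `1/2`-eigenspace of `L_p`. -/
theorem L_mul_L_eq_of_mul_eq_zero (hp : p * p = p) (hc : p * c = 0) :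
    L V p * L V c = (2 : ℝ) • (L V p * L V p * L V c) := by
  ext z
  have h := sq_mul_mul p c z
  have hcomm : p * (c * z) = c * (p * z) :=
    DFunLike.congr_fun (commute_L_of_mul_eq_zero hp hc).eq z
  simp only [hp, hc, zero_mul, smul_zero, ← hcomm] at h
  simp only [Module.End.mul_apply, L_apply, LinearMap.smul_apply]
  linear_combination (norm := module) -h

theorem L_sq_mul_L_of_mul_eq_zero (hp : p * p = p) (hc : p * c = 0) :
    L V (c * c) * L V p = (2 : ℝ) • (L V c * L V c * L V p) := by
  ext z
  have h := sq_mul_mul c p z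
  have hcomm : p * (c * z) = c * (p * z) :=
    DFunLike.congr_fun (commute_L_of_mul_eq_zero hp hc).eq z
  simp only [mul_comm (c * c) p, mul_mul_idempotent_eq_zero hp hc, mul_comm c p, hc, zero_mul,
    smul_zero, hcomm] at h
  simp only [Module.End.mul_apply, L_apply, LinearMap.smul_apply]
  linear_combination (norm := module) -h

/-- The polynomials `λ` and `λ² + 4(λ - λ²)²` agree at `0`, `1/2`, `1`. This writes the self-adjoint
`L_p` as a sum of squares, hence as a positive semidefinite operator. -/
theorem L_idempotent_eq (hp : p * p = p) :
    L V p = L V p * L V p +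
      (4 : ℝ) • ((L V p - L V p * L V p) * (L V p - L V p * L V p)) := by
  have h3 := L_idempotent_cubic hp
  have h4 := congrArg (fun T => T * L V p) h3
  simp only [smul_mul_assoc, sub_mul] at h4
  simp only [mul_sub, sub_mul, ← mul_assoc]
  linear_combination (norm := module) h3 - (2 : ℝ) • h4

theorem inner_idempotent_mul_self (hp : p * p = p) (v : V) :
    inner ℝ (p * v) v = ‖p * v‖ ^ 2 + 4 * ‖p * v - p * (p * v)‖ ^ 2 := by
  have h := DFunLike.congr_fun (L_idempotent_eq hp) v
  simp only [LinearMap.add_apply, LinearMap.smul_apply, Module.End.mul_apply, LinearMap.sub_apply,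
    L_apply] at h
  rw [← real_inner_self_eq_norm_sq, ← real_inner_self_eq_norm_sq]
  conv_lhs => rw [h]
  rw [inner_add_left, inner_smul_left, inner_sub_left, inner_mul, inner_mul, inner_mul p (p * _),
    inner_mul, inner_mul p (p * v - p * (p * v)) (p * v), ← inner_sub_right]
  rfl

theorem inner_idempotent_mul_self_nonneg (hp : p * p = p) (v : V) :
    0 ≤ inner ℝ (p * v) v := by
  rw [inner_idempotent_mul_self hp]
  positivity

theorem mul_eq_zero_of_inner_idempotent_mul_self (hp : p * p = p) {v : V}
    (h : inner ℝ (p * v) v = 0) : p * v = 0 := by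
  rw [inner_idempotent_mul_self hp] at h
  have : ‖p * v‖ ^ 2 = 0 := by nlinarith [sq_nonneg ‖p * v‖, sq_nonneg ‖p * v - p * (p * v)‖]
  simpa using this

/-! ### Power associativity -/

/-- `L_{x^{n+2}} = L_{x²·x^n}` is a polynomial in `L_x`, `L_{x²}`, `L_{x^n}`, `L_{x^{n+1}}` by
`L_sq_mul`, and all of these commute with `L_x` and `L_{x²}`. -/
theorem commute_L_pow (x : V) (n : ℕ) :
    Commute (L V ((L V x ^ n) 1)) (L V x) ∧ Commute (L V ((L V x ^ n) 1)) (L V (x * x)) := by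
  induction n using Nat.twoStepInduction with
  | zero => simp [L_one]
  | one => simpa using (commute_L_sq x).symm
  | more n ih1 ih2 =>
    have key : (L V x ^ (n + 2)) 1 = x * x * (L V x ^ n) 1 := by
      have h := DFunLike.congr_fun ((commute_L_sq x).pow_right n).eq 1
      simp only [Module.End.mul_apply, L_apply, mul_one] at h
      rw [h, pow_add]
      simp [pow_two]
    have key1 : (L V x ^ (n + 1)) 1 = x * (L V x ^ n) 1 := by
      rw [pow_succ']; simp
    rw [key1] at ih2
    rw [key, L_sq_mul]
    have hx := commute_L_sq x
    have c1 := (Commute.refl (L V x))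
    have c2 := (Commute.refl (L V (x * x)))
    exact ⟨((((ih2.1.mul_left c1).smul_left (2 : ℝ)).add_left (hx.mul_left ih1.1)).sub_left
        (((c1.mul_left ih1.1).mul_left c1).smul_left (2 : ℝ))),
      ((((ih2.2.mul_left hx.symm).smul_left (2 : ℝ)).add_left (c2.mul_left ih1.2)).sub_left
        (((hx.symm.mul_left ih1.2).mul_left hx.symm).smul_left (2 : ℝ)))⟩

open Polynomial in
theorem commute_L_aeval (x : V) (f : ℝ[X]) : Commute (L V (aeval (L V x) f 1)) (L V x) := by
  induction f using Polynomial.induction_on' with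
  | add f g hf hg => simpa using hf.add_left hg
  | monomial n a =>
    have := (commute_L_pow x n).1.smul_left a
    simpa [aeval_monomial, Algebra.algebraMap_eq_smul_one] using this

open Polynomial in
-- Multiplicativity of `f ↦ f(L_x) 1` turns Lagrange polynomials on the spectrum of `L_x` into
-- orthogonal idempotents.
theorem aeval_mul_aeval (x : V) (f g : ℝ[X]) :
    aeval (L V x) f 1 * aeval (L V x) g 1 = aeval (L V x) (f * g) 1 := by
  have h : Commute (L V (aeval (L V x) f 1)) (aeval (L V x) g) := by
    induction g using Polynomial.induction_on' with
    | add f g hf hg => simpa using hf.add_right hg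
    | monomial n a =>
      have := ((commute_L_aeval x f).pow_right n).smul_right a
      simpa [aeval_monomial, Algebra.algebraMap_eq_smul_one] using this
  have h1 := DFunLike.congr_fun h.eq 1
  simp only [Module.End.mul_apply, L_apply, mul_one] at h1
  rw [h1, mul_comm f g, map_mul]
  rfl

end JordanIdentities

/-! ### Spectral theorem -/

section Spectral

variable {V : Type*} [EuclideanJordanAlgebra V]

/-- A finite family of mutually orthogonal nonzero idempotents that sum to the unit. -/
structure IsIdempotentFamily {ι : Type*} [Fintype ι] (p : ι → V) : Prop where
  idempotent : ∀ i, p i * p i = p i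
  ne_zero : ∀ i, p i ≠ 0
  orthogonal : ∀ i j, i ≠ j → p i * p j = 0
  sum_eq_one : ∑ i, p i = 1

theorem inner_eq_inner_mul_one (x y : V) : inner ℝ x y = inner ℝ (x * y) 1 := by
  rw [inner_mul, mul_one, real_inner_comm]

theorem IsIdempotentFamily.card_le {ι : Type*} [Fintype ι] {p : ι → V}
    (h : IsIdempotentFamily p) : Fintype.card ι ≤ Module.finrank ℝ V := by
  apply LinearIndependent.fintype_card_le_finrank (b := p)
  refine linearIndependent_of_ne_zero_of_inner_eq_zero (𝕜 := ℝ) h.ne_zero fun i j hij => ?_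
  change inner ℝ (p i) (p j) = 0
  rw [inner_eq_inner_mul_one, h.orthogonal i j hij, inner_zero_left]

theorem IsIdempotentFamily.comp_equiv {ι κ : Type*} [Fintype ι] [Fintype κ] {p : ι → V}
    (h : IsIdempotentFamily p) (e : κ ≃ ι) : IsIdempotentFamily (p ∘ e) where
  idempotent _ := h.idempotent _
  ne_zero _ := h.ne_zero _
  orthogonal _ _ hij := h.orthogonal _ _ (e.injective.ne hij)
  sum_eq_one := (e.sum_comp p).trans h.sum_eq_one

open Polynomial in
/-- Spectral resolution with respect to the distinct eigenvalues of `L_x`. -/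
theorem exists_idempotentFamily (x : V) :
    ∃ (n : ℕ) (p : Fin n → V) (lam : Fin n → ℝ), IsIdempotentFamily p ∧ x = ∑ i, lam i • p i := by
  classical
  set T := L V x with hT
  set b := (isSymmetric_L x).eigenvectorBasis rfl
  set μ := (isSymmetric_L x).eigenvalues rfl
  have hTb : ∀ i, T (b i) = μ i • b i := (isSymmetric_L x).apply_eigenvectorBasis rfl
  have haeval : ∀ (f : ℝ[X]) i, aeval T f (b i) = f.eval (μ i) • b i := by
    intro f i
    by_cases h0 : b i = 0
    · simp [h0]
    · exact Module.End.aeval_apply_of_hasEigenvector ⟨Module.End.mem_eigenspace_iff.2 (hTb i), h0⟩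
  have hext : ∀ f g : ℝ[X], (∀ i, f.eval (μ i) = g.eval (μ i)) → aeval T f = aeval T g := by
    intro f g h
    refine b.toBasis.ext fun i => ?_
    simp [haeval, h]
  set s : Finset ℝ := Finset.univ.image μ
  have hmem : ∀ i, μ i ∈ s := fun i => Finset.mem_image_of_mem _ (Finset.mem_univ i)
  set e : ℝ → V := fun a => aeval T (Lagrange.basis s id a) 1 with he
  have hinj : Set.InjOn (id : ℝ → ℝ) s := Set.injOn_id _
  have hself : ∀ a ∈ s, (Lagrange.basis s id a).eval a = 1 := fun a ha =>
    Lagrange.eval_basis_self (v := id) hinj ha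
  have hne : ∀ a b, a ≠ b → b ∈ s → (Lagrange.basis s id a).eval b = 0 := fun a b hab hb =>
    Lagrange.eval_basis_of_ne (v := id) hab hb
  have hidem : ∀ a ∈ s, e a * e a = e a := by
    intro a ha
    rw [he, aeval_mul_aeval]
    congr 1
    refine hext _ _ fun i => ?_
    rw [eval_mul]
    by_cases h : a = μ i
    · rw [← h, hself a ha, _root_.one_mul]
    · rw [hne a _ h (hmem i), MulZeroClass.zero_mul]
  have horth : ∀ a ∈ s, ∀ c ∈ s, a ≠ c → e a * e c = 0 := by
    intro a ha c hc hac
    rw [he, aeval_mul_aeval]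
    have : aeval T (Lagrange.basis s id a * Lagrange.basis s id c) = aeval T (0 : ℝ[X]) := by
      refine hext _ _ fun i => ?_
      rw [eval_mul, eval_zero]
      by_cases h : a = μ i
      · rw [hne c _ (fun h' => hac (h.trans h'.symm)) (hmem i), MulZeroClass.mul_zero]
      · rw [hne a _ h (hmem i), MulZeroClass.zero_mul]
    rw [← hT, this]
    simp
  have hcomb : ∀ f : ℝ[X], ∑ a ∈ s, f.eval a • e a = aeval T f 1 := by
    intro f
    have : aeval T f = aeval T (∑ a ∈ s, f.eval a • Lagrange.basis s id a) := by
      refine hext _ _ fun i => ?_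
      rw [eval_finsetSum, Finset.sum_eq_single (μ i)]
      · simp [hself _ (hmem i)]
      · intro a _ ha
        simp [hne a _ ha (hmem i)]
      · exact fun h => absurd (hmem i) h
    rw [this, map_sum]
    simp [he]
  -- Eigenvalues of `L_x` need not be eigenvalues of `x`; at the others the projection of `1`
  -- vanishes and is discarded.
  set s' := s.filter fun a => e a ≠ 0 with hs'
  have hcomb' : ∀ f : ℝ[X], ∑ a : s', f.eval (a : ℝ) • e a = aeval T f 1 := by
    intro f
    rw [← hcomb, Finset.sum_coe_sort s' (fun a => f.eval a • e a), hs', Finset.sum_filter]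
    refine Finset.sum_congr rfl fun a _ => ?_
    by_cases h : e a = 0 <;> simp [h]
  have hfam : IsIdempotentFamily fun a : s' => e a :=
    { idempotent := fun a => hidem a (Finset.mem_filter.1 a.2).1
      ne_zero := fun a => (Finset.mem_filter.1 a.2).2
      orthogonal := fun a c hac => horth a (Finset.mem_filter.1 a.2).1 c
        (Finset.mem_filter.1 c.2).1 fun h => hac (Subtype.ext h)
      sum_eq_one := by simpa using hcomb' 1 }
  refine ⟨_, _, fun i => ((s'.equivFin).symm i : ℝ), hfam.comp_equiv s'.equivFin.symm, ?_⟩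
  have := hcomb' X
  simp only [eval_X, aeval_X, hT, L_apply, mul_one] at this
  rw [← this, ← s'.equivFin.symm.sum_comp]
  rfl

/-- `⟨av,v⟩` and `⟨bv,v⟩` are nonnegative with sum zero. Thus, when an idempotent is split, its
parts stay orthogonal to the rest of the family. -/
theorem mul_eq_zero_of_add_idempotent {a b v : V} (ha : a * a = a) (hb : b * b = b)
    (h : (a + b) * v = 0) : a * v = 0 ∧ b * v = 0 := by
  have h1 : inner ℝ (a * v) v + inner ℝ (b * v) v = (0 : ℝ) := by
    rw [← inner_add_left, ← add_mul, h, inner_zero_left]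
  have h2 := inner_idempotent_mul_self_nonneg ha v
  have h3 := inner_idempotent_mul_self_nonneg hb v
  exact ⟨mul_eq_zero_of_inner_idempotent_mul_self ha (by linarith),
    mul_eq_zero_of_inner_idempotent_mul_self hb (by linarith)⟩

theorem mul_eq_zero_of_add_idempotent_eq {a b p : V} (ha : a * a = a) (hb : b * b = b)
    (hp : p * p = p) (h : p = a + b) : a * b = 0 := by
  rw [h, add_mul, mul_add, mul_add, ha, hb, mul_comm b a] at hp
  have : (2 : ℝ) • (a * b) = 0 := by linear_combination (norm := module) hp
  simpa using this

theorem IsIdempotentFamily.split {ι : Type*} [Fintype ι] [DecidableEq ι] {p : ι → V}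
    (h : IsIdempotentFamily p) (i : ι) {a b : V} (ha : a * a = a) (hb : b * b = b)
    (ha0 : a ≠ 0) (hb0 : b ≠ 0) (hab : p i = a + b) :
    IsIdempotentFamily fun o : Option ι => o.elim a (Function.update p i b) := by
  have hab0 := mul_eq_zero_of_add_idempotent_eq ha hb (h.idempotent i) hab
  have horth : ∀ j, j ≠ i → a * p j = 0 ∧ b * p j = 0 := fun j hj =>
    mul_eq_zero_of_add_idempotent ha hb (by rw [← hab, h.orthogonal i j hj.symm])
  have hu : ∀ j, j ≠ i → Function.update p i b j = p j := fun j hj =>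
    Function.update_of_ne hj _ _
  have hui : Function.update p i b i = b := Function.update_self _ _ _
  have haj : ∀ j, a * Function.update p i b j = 0 := by
    intro j
    by_cases hj : j = i
    · rw [hj, hui, hab0]
    · rw [hu j hj, (horth j hj).1]
  refine ⟨?_, ?_, ?_, ?_⟩
  · rintro (_ | j)
    · exact ha
    · by_cases hj : j = i
      · simp only [Option.elim, hj, hui, hb]
      · simp only [Option.elim, hu j hj, h.idempotent]
  · rintro (_ | j)
    · exact ha0
    · by_cases hj : j = i
      · simp only [Option.elim, hj, hui]; exact hb0
      · simp only [Option.elim, hu j hj]; exact h.ne_zero j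
  · rintro (_ | j) (_ | k) hjk
    · exact absurd rfl hjk
    · exact haj k
    · exact (mul_comm _ _).trans (haj j)
    · have hjk' : j ≠ k := fun e => hjk (by rw [e])
      simp only [Option.elim]
      by_cases hj : j = i
      · subst hj
        rw [hui, hu k hjk'.symm, (horth k hjk'.symm).2]
      · by_cases hk : k = i
        · subst hk
          rw [hui, hu j hj, mul_comm, (horth j hj).2]
        · rw [hu j hj, hu k hk, h.orthogonal j k hjk']
  · rw [Fintype.sum_option, ← h.sum_eq_one]
    simp only [Option.elim]
    rw [Finset.sum_update_of_mem (Finset.mem_univ i), ← add_assoc, ← hab,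
      Finset.sdiff_singleton_eq_erase, Finset.add_sum_erase _ _ (Finset.mem_univ i)]

theorem sum_smul_split {ι : Type*} [Fintype ι] [DecidableEq ι] {p : ι → V}
    (lam : ι → ℝ) (i : ι) {a b : V} (hab : p i = a + b) :
    ∑ o : Option ι, o.elim (lam i) lam • (o.elim a (Function.update p i b) : V) =
      ∑ j, lam j • p j := by
  rw [Fintype.sum_option]
  simp only [Option.elim]
  rw [← Finset.add_sum_erase _ _ (Finset.mem_univ i), ← add_assoc, Function.update_self, ← smul_add,
    ← hab, ← Finset.add_sum_erase _ (fun j => lam j • p j) (Finset.mem_univ i)]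
  congr 1
  refine Finset.sum_congr rfl fun j hj => ?_
  rw [Function.update_of_ne (Finset.ne_of_mem_erase hj)]

theorem nonempty_spectralDecomposition (x : V) : Nonempty (SpectralDecomposition x) := by
  classical
  obtain ⟨n, p, lam, hp, hx⟩ := exists_idempotentFamily x
  -- Induction on the defect `dim V - n`: splitting a non-primitive member enlarges the family,
  -- whose size is bounded by the dimension.
  obtain ⟨k, hk⟩ : ∃ k, k = Module.finrank ℝ V - n := ⟨_, rfl⟩
  induction k using Nat.strong_induction_on generalizing n with
  | _ k ih =>
    by_cases hprim : ∀ i, IsPrimitiveIdempotent (p i)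
    · exact ⟨⟨n, lam, p, ⟨hprim, hp.orthogonal, hp.sum_eq_one⟩, hx⟩⟩
    · obtain ⟨i, hi⟩ := not_forall.1 hprim
      have hi' : ∃ a b : V, a * a = a ∧ b * b = b ∧ a ≠ 0 ∧ b ≠ 0 ∧ p i = a + b := by
        by_contra hcon
        exact hi ⟨hp.idempotent i, hp.ne_zero i, hcon⟩
      obtain ⟨a, b, ha, hb, ha0, hb0, hab⟩ := hi'
      have hs := hp.split i ha hb ha0 hb0 hab
      have hcard := hs.card_le
      have e : Fin (n + 1) ≃ Option (Fin n) := finSuccEquiv n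
      rw [Fintype.card_option, Fintype.card_fin] at hcard
      refine ih (Module.finrank ℝ V - (n + 1)) (by omega) (n + 1) _
        ((fun o : Option (Fin n) => o.elim (lam i) lam) ∘ e) (hs.comp_equiv e) ?_ rfl
      rw [hx, ← sum_smul_split lam i hab, ← e.sum_comp]
      rfl

end Spectral

/-! ### Cone of squares, its interior, and the trace -/

section Cone

variable {V : Type*} [EuclideanJordanAlgebra V]

theorem exists_jordanFrame (x : V) :
    ∃ (n : ℕ) (p : Fin n → V) (lam : Fin n → ℝ), IsJordanFrame p ∧ x = ∑ i, lam i • p i :=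
  let ⟨d⟩ := nonempty_spectralDecomposition x
  ⟨d.n, d.p, d.lam, d.isJordanFrame, d.eq_sum⟩

theorem inner_idempotent_nonneg {p q : V} (hp : p * p = p) (hq : q * q = q) :
    0 ≤ inner ℝ p q := by
  have := inner_idempotent_mul_self_nonneg hp q
  rwa [mul_comm, inner_mul, hq] at this

theorem mul_eq_zero_of_inner_idempotent {p q : V} (hp : p * p = p) (hq : q * q = q)
    (h : inner ℝ p q = 0) : p * q = 0 := by
  apply mul_eq_zero_of_inner_idempotent_mul_self hp
  rw [mul_comm, inner_mul, hq, h]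

theorem inner_eq_zero_of_mul_eq_zero {p q : V} (h : p * q = 0) : inner ℝ p q = 0 := by
  rw [inner_eq_inner_mul_one, h, inner_zero_left]

namespace IsJordanFrame

variable {n : ℕ} {p : Fin n → V}

theorem idempotent (h : IsJordanFrame p) (i : Fin n) : p i * p i = p i := (h.primitive i).1

theorem ne_zero (h : IsJordanFrame p) (i : Fin n) : p i ≠ 0 := (h.primitive i).2.1

theorem sum_smul_mul (h : IsJordanFrame p) (a : Fin n → ℝ) (i : Fin n) :
    (∑ j, a j • p j) * p i = a i • p i := by
  rw [Finset.sum_mul, Finset.sum_eq_single i]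
  · rw [smul_mul, h.idempotent]
  · intro j _ hj
    rw [smul_mul, h.orthogonal j i hj, smul_zero]
  · simp

theorem sum_mul_sum (h : IsJordanFrame p) (a b : Fin n → ℝ) :
    (∑ i, a i • p i) * (∑ i, b i • p i) = ∑ i, (a i * b i) • p i := by
  rw [Finset.mul_sum]
  refine Finset.sum_congr rfl fun i _ => ?_
  rw [mul_smul', h.sum_smul_mul, smul_smul, _root_.mul_comm]

theorem inner_sum_smul (h : IsJordanFrame p) (a : Fin n → ℝ) (i : Fin n) :
    inner ℝ (∑ j, a j • p j) (p i) = a i * ‖p i‖ ^ 2 := by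
  rw [inner_eq_inner_mul_one, h.sum_smul_mul, inner_smul_left]
  conv_lhs => rw [← h.idempotent i, ← inner_eq_inner_mul_one, real_inner_self_eq_norm_sq]
  rfl

theorem norm_sq_pos (h : IsJordanFrame p) (i : Fin n) : 0 < ‖p i‖ ^ 2 := by
  have := norm_pos_iff.2 (h.ne_zero i)
  positivity

end IsJordanFrame

/-- The cone of squares is self-dual. -/
theorem mem_cone_iff_inner {x : V} : x ∈ cone V ↔ ∀ v : V, 0 ≤ inner ℝ x (v * v) := by
  constructor
  · rintro ⟨w, rfl⟩ v
    obtain ⟨n, p, lam, hp, rfl⟩ := exists_jordanFrame w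
    rw [hp.sum_mul_sum, sum_inner]
    refine Finset.sum_nonneg fun i _ => ?_
    rw [inner_smul_left, ← inner_mul, mul_comm v]
    exact mul_nonneg (mul_self_nonneg _) (inner_idempotent_mul_self_nonneg (hp.idempotent i) v)
  · intro h
    obtain ⟨n, p, lam, hp, rfl⟩ := exists_jordanFrame x
    have hl : ∀ i, 0 ≤ lam i := fun i => by
      have h1 := h (p i)
      rw [hp.idempotent, hp.inner_sum_smul] at h1
      exact nonneg_of_mul_nonneg_left h1 (hp.norm_sq_pos i)
    refine ⟨∑ i, Real.sqrt (lam i) • p i, ?_⟩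
    rw [hp.sum_mul_sum]
    exact Finset.sum_congr rfl fun i _ => by rw [Real.mul_self_sqrt (hl i)]

theorem mem_cone_of_idempotent {p : V} (hp : p * p = p) : p ∈ cone V := ⟨p, hp.symm⟩

theorem one_mem_cone : (1 : V) ∈ cone V := ⟨1, (one_mul 1).symm⟩

theorem inner_nonneg_of_mem_cone {x y : V} (hx : x ∈ cone V) (hy : y ∈ cone V) :
    0 ≤ inner ℝ x y := by
  obtain ⟨w, rfl⟩ := hy
  exact mem_cone_iff_inner.1 hx w

theorem isClosed_cone : IsClosed (cone V) := by
  have : cone V = ⋂ v : V, {x | 0 ≤ inner ℝ x (v * v)} := by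
    ext x
    simp [mem_cone_iff_inner]
  rw [this]
  exact isClosed_iInter fun v => isClosed_le continuous_const (by fun_prop)

theorem add_mem_cone {x y : V} (hx : x ∈ cone V) (hy : y ∈ cone V) : x + y ∈ cone V :=
  mem_cone_iff_inner.2 fun v => by
    rw [inner_add_left]
    exact add_nonneg (mem_cone_iff_inner.1 hx v) (mem_cone_iff_inner.1 hy v)

theorem smul_mem_cone {c : ℝ} (hc : 0 ≤ c) {x : V} (hx : x ∈ cone V) : c • x ∈ cone V :=
  mem_cone_iff_inner.2 fun v => by
    rw [inner_smul_left]
    exact mul_nonneg hc (mem_cone_iff_inner.1 hx v)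

theorem IsJordanFrame.sum_smul_mem_cone_iff {n : ℕ} {p : Fin n → V} (hp : IsJordanFrame p)
    {a : Fin n → ℝ} : ∑ i, a i • p i ∈ cone V ↔ ∀ i, 0 ≤ a i := by
  constructor
  · intro h i
    have h1 := inner_nonneg_of_mem_cone h (mem_cone_of_idempotent (hp.idempotent i))
    rw [hp.inner_sum_smul] at h1
    exact nonneg_of_mul_nonneg_left h1 (hp.norm_sq_pos i)
  · intro h
    refine ⟨∑ i, Real.sqrt (a i) • p i, ?_⟩
    rw [hp.sum_mul_sum]
    exact Finset.sum_congr rfl fun i _ => by rw [Real.mul_self_sqrt (h i)]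

theorem exists_norm_mul_le : ∃ C : ℝ, 0 < C ∧ ∀ x y : V, ‖x * y‖ ≤ C * ‖x‖ * ‖y‖ := by
  let B : V →L[ℝ] V →L[ℝ] V :=
    LinearMap.toContinuousLinearMap ((LinearMap.toContinuousLinearMap :
      (V →ₗ[ℝ] V) ≃ₗ[ℝ] V →L[ℝ] V).toLinearMap ∘ₗ L V)
  refine ⟨‖B‖ + 1, by positivity, fun x y => (B.le_opNorm₂ x y).trans ?_⟩
  gcongr
  linarith

/-- For the converse, a perturbation `y - x` of norm below `ε / C` satisfies `|⟨(y - x)v,v⟩| ≤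
ε‖v‖²`, so self-duality puts `ε • 1 + (y - x)` in the cone. -/
theorem mem_interior_cone_iff {x : V} :
    x ∈ interior (cone V) ↔ ∃ ε > 0, x - (ε : ℝ) • (1 : V) ∈ cone V := by
  constructor
  · intro hx
    have hc : Continuous fun ε : ℝ => x - ε • (1 : V) := by fun_prop
    have h0 : (fun ε : ℝ => x - ε • (1 : V)) ⁻¹' interior (cone V) ∈ nhds 0 :=
      hc.continuousAt.preimage_mem_nhds (isOpen_interior.mem_nhds (by simpa using hx))
    obtain ⟨ε, hε, hball⟩ := Metric.mem_nhds_iff.1 h0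
    refine ⟨ε / 2, by positivity, interior_subset (hball ?_)⟩
    rw [Metric.mem_ball, dist_zero_right, Real.norm_eq_abs, abs_of_pos (by positivity)]
    linarith
  · rintro ⟨ε, hε, hx⟩
    obtain ⟨C, hC, hmul⟩ := exists_norm_mul_le (V := V)
    refine mem_interior_iff_mem_nhds.2 (Metric.mem_nhds_iff.2 ⟨ε / C, by positivity, fun y hy => ?_⟩)
    have hsplit : y = (x - ε • (1 : V)) + (ε • (1 : V) + (y - x)) := by abel
    rw [hsplit]
    refine add_mem_cone hx (mem_cone_iff_inner.2 fun v => ?_)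
    rw [inner_add_left, inner_smul_left, ← inner_mul, ← inner_mul, mul_one,
      mul_comm v]
    have h1 : ‖y - x‖ * C ≤ ε := by
      rw [Metric.mem_ball, dist_eq_norm, lt_div_iff₀ hC] at hy
      exact hy.le
    have h2 : |inner ℝ ((y - x) * v) v| ≤ ε * (‖v‖ * ‖v‖) := by
      refine (abs_real_inner_le_norm _ _).trans ?_
      calc ‖(y - x) * v‖ * ‖v‖ ≤ (C * ‖y - x‖ * ‖v‖) * ‖v‖ := by gcongr; exact hmul _ _
        _ = (‖y - x‖ * C) * (‖v‖ * ‖v‖) := by ring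
        _ ≤ ε * (‖v‖ * ‖v‖) := by gcongr
    have h3 := (abs_le.1 h2).1
    rw [real_inner_self_eq_norm_mul_norm]
    simp only [conj_trivial]
    linarith

theorem exists_pos_forall_le {n : ℕ} {a : Fin n → ℝ} (ha : ∀ i, 0 < a i) :
    ∃ ε > 0, ∀ i, ε ≤ a i := by
  rcases isEmpty_or_nonempty (Fin n) with h | h
  · exact ⟨1, one_pos, fun i => h.elim i⟩
  · obtain ⟨i, hi⟩ := Finite.exists_min a
    exact ⟨a i, ha i, hi⟩

theorem IsJordanFrame.sum_smul_sub_smul_one {n : ℕ} {p : Fin n → V} (hp : IsJordanFrame p)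
    (a : Fin n → ℝ) (c : ℝ) : ∑ i, a i • p i - c • (1 : V) = ∑ i, (a i - c) • p i := by
  rw [← hp.sum_eq_one, Finset.smul_sum, ← Finset.sum_sub_distrib]
  exact Finset.sum_congr rfl fun i _ => (sub_smul _ _ _).symm

theorem IsJordanFrame.sum_smul_mem_interior_iff {n : ℕ} {p : Fin n → V} (hp : IsJordanFrame p)
    {a : Fin n → ℝ} : ∑ i, a i • p i ∈ interior (cone V) ↔ ∀ i, 0 < a i := by
  simp only [mem_interior_cone_iff, hp.sum_smul_sub_smul_one, hp.sum_smul_mem_cone_iff]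
  constructor
  · rintro ⟨ε, hε, h⟩ i
    linarith [h i]
  · intro h
    obtain ⟨ε, hε, h'⟩ := exists_pos_forall_le h
    exact ⟨ε, hε, fun i => by linarith [h' i]⟩

/-! ### The trace -/

/-- A nonzero idempotent below a primitive idempotent equals it. -/
theorem IsPrimitiveIdempotent.eq_of_mul_eq {c e : V} (hc : IsPrimitiveIdempotent c)
    (he : e * e = e) (he0 : e ≠ 0) (h : c * e = e) : e = c := by
  by_contra hne
  refine hc.2.2 ⟨e, c - e, he, ?_, he0, sub_ne_zero.2 (Ne.symm hne), by abel⟩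
  rw [sub_mul, mul_sub, mul_sub, hc.1, he, h, mul_comm e c, h]
  abel

/-- `x²` is orthogonal to `1 - c`, so each spectral idempotent of `x` with nonzero eigenvalue is
annihilated by `1 - c`; primitivity forces it to be `c`. -/
theorem IsPrimitiveIdempotent.mem_span_of_mul_eq {c x : V} (hc : IsPrimitiveIdempotent c)
    (h : c * x = x) : ∃ a : ℝ, x = a • c := by
  have hq : (1 - c) * (1 - c) = 1 - c := by
    rw [sub_mul, one_mul, mul_sub, mul_one, hc.1]; abel
  have hqx : (1 - c) * x = 0 := by rw [sub_mul, one_mul, h, sub_self]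
  have hqxx := inner_eq_zero_of_mul_eq_zero (mul_mul_idempotent_eq_zero hq hqx)
  obtain ⟨n, p, lam, hp, rfl⟩ := exists_jordanFrame x
  rw [hp.sum_mul_sum, inner_sum] at hqxx
  have hterm : ∀ i ∈ Finset.univ, 0 ≤ inner ℝ (1 - c) ((lam i * lam i) • p i) := fun i _ => by
    rw [inner_smul_right]
    exact mul_nonneg (mul_self_nonneg _) (inner_idempotent_nonneg hq (hp.idempotent i))
  have key : ∀ i, ∃ b : ℝ, lam i • p i = b • c := by
    intro i
    have h0 := (Finset.sum_eq_zero_iff_of_nonneg hterm).1 hqxx i (Finset.mem_univ i)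
    rw [inner_smul_right] at h0
    rcases _root_.mul_eq_zero.1 h0 with h1 | h1
    · exact ⟨0, by rw [mul_self_eq_zero.1 h1, zero_smul, zero_smul]⟩
    · have h2 := mul_eq_zero_of_inner_idempotent hq (hp.idempotent i) h1
      rw [sub_mul, one_mul, sub_eq_zero] at h2
      rw [hc.eq_of_mul_eq (hp.idempotent i) (hp.ne_zero i) h2.symm]
      exact ⟨_, rfl⟩
  choose b hb using key
  exact ⟨∑ i, b i, by rw [Finset.sum_smul]; exact Finset.sum_congr rfl fun i _ => hb i⟩

/-- `U_c d` is fixed by `L_c`, hence a multiple of `c`; pairing with `c` determines the factor. -/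
theorem IsPrimitiveIdempotent.inner_quadRep {c d : V} (hc : IsPrimitiveIdempotent c) :
    inner ℝ d (quadRep c d) * ‖c‖ ^ 2 = (inner ℝ c d) ^ 2 := by
  have hmul : c * quadRep c d = quadRep c d := by
    have h := DFunLike.congr_fun (L_idempotent_cubic hc.1) d
    simp only [LinearMap.smul_apply, Module.End.mul_apply, LinearMap.sub_apply, L_apply] at h
    rw [quadRep, hc.1, mul_sub, mul_smul']
    linear_combination (norm := module) h
  obtain ⟨a, ha⟩ := hc.mem_span_of_mul_eq hmul
  have h1 : inner ℝ c (quadRep c d) = inner ℝ c d := by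
    rw [quadRep, hc.1, inner_sub_right, inner_smul_right, ← inner_mul, hc.1, ← inner_mul, hc.1]
    ring
  rw [ha, inner_smul_right, real_inner_self_eq_norm_sq] at h1
  rw [ha, inner_smul_right, real_inner_comm, ← h1]
  ring

/-- Primitive idempotents that are not orthogonal have the same norm. -/
theorem IsPrimitiveIdempotent.norm_sq_eq {c d : V} (hc : IsPrimitiveIdempotent c)
    (hd : IsPrimitiveIdempotent d) (h : inner ℝ c d ≠ 0) : ‖c‖ ^ 2 = ‖d‖ ^ 2 := by
  have h1 := hc.inner_quadRep (d := d)
  have h2 := hd.inner_quadRep (d := c)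
  -- The expression `⟨d, U_c d⟩` is symmetric in the two idempotents, so the two formulas for it can
  -- be compared.
  have h3 : inner ℝ d (quadRep c d) = inner ℝ c (quadRep d c) := by
    have e1 : inner ℝ d (c * (c * d)) = inner ℝ c (d * (d * c)) := by
      rw [← inner_mul, ← inner_mul d, mul_comm d c]
    have e2 : inner ℝ d (c * d) = inner ℝ c (d * c) := by
      rw [mul_comm c d, ← inner_mul, hd.1, mul_comm d c, ← inner_mul, hc.1, real_inner_comm]
    rw [quadRep, quadRep, hc.1, hd.1, inner_sub_right, inner_sub_right, inner_smul_right,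
      inner_smul_right, e1, e2]
  have h4 : inner ℝ c (quadRep d c) ≠ 0 := by
    intro h0
    rw [h0, MulZeroClass.zero_mul, real_inner_comm c d] at h2
    exact h (pow_eq_zero_iff two_ne_zero |>.1 h2.symm)
  rw [h3] at h1
  rw [real_inner_comm c d] at h2
  exact mul_left_cancel₀ h4 (h1.trans h2.symm)

variable (V) in
/-- The trace is the linear form that takes the value `1` at every primitive idempotent. -/
theorem exists_linearMap_primitive_eq_one :
    ∃ T : V →ₗ[ℝ] ℝ, ∀ c : V, IsPrimitiveIdempotent c → T c = 1 := by
  obtain ⟨n, p, -, hp, -⟩ := exists_jordanFrame (0 : V)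
  -- For primitive `c`, every frame member not orthogonal to `c` has the norm of `c`, so the form
  -- takes the value `⟨1,c⟩ / ‖c‖² = 1`.
  refine ⟨∑ i, (‖p i‖ ^ 2)⁻¹ • (innerₛₗ ℝ (p i)), fun c hc => ?_⟩
  have hc0 : ‖c‖ ^ 2 ≠ 0 := by
    have := norm_ne_zero_iff.2 hc.2.1
    positivity
  have hterm : ∀ i, (‖p i‖ ^ 2)⁻¹ * inner ℝ (p i) c = (‖c‖ ^ 2)⁻¹ * inner ℝ (p i) c := by
    intro i
    by_cases h : inner ℝ (p i) c = 0
    · simp [h]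
    · rw [(hp.primitive i).norm_sq_eq hc h]
  simp only [LinearMap.sum_apply, LinearMap.smul_apply, innerₛₗ_apply_apply, smul_eq_mul, hterm]
  rw [← Finset.mul_sum, ← sum_inner, hp.sum_eq_one, real_inner_comm]
  have h1 := inner_eq_inner_mul_one c c
  rw [hc.1, real_inner_self_eq_norm_sq] at h1
  rw [← h1]
  exact inv_mul_cancel₀ hc0

variable (V) in
/-- The trace as a linear form. -/
noncomputable def traceForm : V →ₗ[ℝ] ℝ := (exists_linearMap_primitive_eq_one V).choose

theorem IsJordanFrame.traceForm_sum {n : ℕ} {p : Fin n → V} (hp : IsJordanFrame p)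
    (a : Fin n → ℝ) : traceForm V (∑ i, a i • p i) = ∑ i, a i := by
  rw [map_sum]
  refine Finset.sum_congr rfl fun i _ => ?_
  rw [map_smul, traceForm, (exists_linearMap_primitive_eq_one V).choose_spec _ (hp.primitive i),
    smul_eq_mul, _root_.mul_one]

theorem trace_eq_traceForm (x : V) : trace x = traceForm V x := by
  have h := nonempty_spectralDecomposition x
  rw [trace, dif_pos h]
  conv_rhs => rw [h.some.eq_sum]
  rw [h.some.isJordanFrame.traceForm_sum]

theorem traceForm_pos {x : V} [Nontrivial V] (hx : x ∈ interior (cone V)) : 0 < traceForm V x := by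
  obtain ⟨n, p, lam, hp, rfl⟩ := exists_jordanFrame x
  rw [hp.traceForm_sum]
  have hne : Nonempty (Fin n) := by
    by_contra h
    rw [not_nonempty_iff] at h
    have := hp.sum_eq_one
    rw [Finset.sum_of_isEmpty] at this
    exact absurd this.symm one_ne_zero
  exact Finset.sum_pos (fun i _ => hp.sum_smul_mem_interior_iff.1 hx i) Finset.univ_nonempty

end Cone

/-! ### Positivity and inversion of the quadratic representation -/

section QuadraticRepresentation

variable {V : Type*} [EuclideanJordanAlgebra V]

/-- The quadratic representation as a linear map. -/
noncomputable def quadRepLin (a : V) : Module.End ℝ V := (2 : ℝ) • (L V a * L V a) - L V (a * a)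

/-- The operator with eigenvalues `s`, `t`, `1` on the Peirce spaces of `p` for the eigenvalues
`1`, `1/2`, `0` of `L_p`. -/
noncomputable def peirce (p : V) (s t : ℝ) : Module.End ℝ V :=
  1 + (4 * t - s - 3) • L V p + (2 * s - 4 * t + 2) • (L V p * L V p)

variable {p c : V}

theorem peirce_mul_peirce (hp : p * p = p) (s t s' t' : ℝ) :
    peirce p s t * peirce p s' t' = peirce p (s * s') (t * t') := by
  have h3 := L_idempotent_cubic hp
  have h4 := congrArg (fun T => T * L V p) h3
  simp only [smul_mul_assoc, _root_.sub_mul, mul_assoc] at h4 h3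
  simp only [peirce, _root_.mul_add, _root_.add_mul, smul_mul_assoc, mul_smul_comm, mul_assoc,
    MulOneClass.mul_one, MulOneClass.one_mul]
  -- The cubic relation eliminates `L_p³`, and its multiple by `L_p` eliminates `L_p⁴`; the term
  -- `3/4` accounts for the cubes which the latter produces.
  linear_combination (norm := module)
    (((4 * t - s - 3) * (2 * s' - 4 * t' + 2) + (4 * t' - s' - 3) * (2 * s - 4 * t + 2)) / 2 +
      3 / 4 * ((2 * s - 4 * t + 2) * (2 * s' - 4 * t' + 2))) • h3 +
      ((2 * s - 4 * t + 2) * (2 * s' - 4 * t' + 2) / 2) • h4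

theorem peirce_one_one (p : V) : peirce p 1 1 = 1 := by
  rw [peirce]
  module

theorem peirce_pow (hp : p * p = p) (s t : ℝ) (n : ℕ) :
    peirce p s t ^ n = peirce p (s ^ n) (t ^ n) := by
  induction n with
  | zero => simp [peirce_one_one]
  | succ n ih => rw [pow_succ, ih, peirce_mul_peirce hp, pow_succ, pow_succ]

theorem peirce_apply (p : V) (s t : ℝ) (z : V) :
    peirce p s t z = z + (4 * t - s - 3) • (p * z) + (2 * s - 4 * t + 2) • (p * (p * z)) := rfl

theorem peirce_one_sub (p : V) (h : ℝ) : peirce p (1 - h) (1 - h / 2) = 1 - h • L V p := by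
  rw [peirce]
  module

/-- The resolvent of `L_p` is positive. -/
theorem mem_cone_of_sub_smul_mul_mem_cone (hp : p * p = p) {h : ℝ} (h1 : h < 1) {z : V}
    (hz : z - h • (p * z) ∈ cone V) : z ∈ cone V := by
  obtain ⟨n, q, lam, hq, rfl⟩ := exists_jordanFrame z
  refine hq.sum_smul_mem_cone_iff.2 fun i => ?_
  -- Pairing with `q i` gives `lam i * (‖q i‖² - h⟨p, q i⟩) ≥ 0`. The second factor is positive
  -- since `0 ≤ ⟨p, q i⟩ ≤ ‖q i‖²` and `h < 1`.
  have hi := inner_nonneg_of_mem_cone hz (mem_cone_of_idempotent (hq.idempotent i))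
  have e1 : inner ℝ (p * ∑ j, lam j • q j) (q i) = lam i * inner ℝ p (q i) := by
    rw [mul_comm, inner_mul, hq.sum_smul_mul, inner_smul_right]
  have hpq := inner_idempotent_nonneg hp (hq.idempotent i)
  have hp1 : (1 - p) * (1 - p) = 1 - p := by
    rw [sub_mul, one_mul, mul_sub, mul_one, hp]; abel
  have hpq1 := inner_idempotent_nonneg hp1 (hq.idempotent i)
  have e2 : inner ℝ 1 (q i) = ‖q i‖ ^ 2 := by
    rw [real_inner_comm]
    conv_lhs => rw [← hq.idempotent i, ← inner_eq_inner_mul_one, real_inner_self_eq_norm_sq]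
  rw [inner_sub_left, e2] at hpq1
  rw [inner_sub_left, hq.inner_sum_smul, inner_smul_left, e1] at hi
  simp only [conj_trivial] at hi
  have hpos : 0 < ‖q i‖ ^ 2 - h * inner ℝ p (q i) := by
    have := hq.norm_sq_pos i
    rcases le_or_gt h 0 with h0 | h0 <;> nlinarith
  refine nonneg_of_mul_nonneg_left (b := ‖q i‖ ^ 2 - h * inner ℝ p (q i)) ?_ hpos
  linarith

theorem peirce_inv_mem_cone (hp : p * p = p) {h : ℝ} (h1 : h < 1) {z : V} (hz : z ∈ cone V) :
    peirce p (1 - h)⁻¹ (1 - h / 2)⁻¹ z ∈ cone V := by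
  apply mem_cone_of_sub_smul_mul_mem_cone hp h1
  have e := DFunLike.congr_fun
    (peirce_mul_peirce hp (1 - h) (1 - h / 2) (1 - h)⁻¹ (1 - h / 2)⁻¹) z
  rw [mul_inv_cancel₀ (by linarith), mul_inv_cancel₀ (by linarith), peirce_one_one,
    peirce_one_sub] at e
  simp only [Module.End.mul_apply, Module.End.one_apply, LinearMap.sub_apply,
    LinearMap.smul_apply, L_apply] at e
  rwa [e]

theorem peirce_inv_pow_mem_cone (hp : p * p = p) {h : ℝ} (h1 : h < 1) (n : ℕ) {z : V}
    (hz : z ∈ cone V) : (peirce p (1 - h)⁻¹ (1 - h / 2)⁻¹ ^ n) z ∈ cone V := by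
  induction n with
  | zero => exact hz
  | succ n ih =>
    rw [pow_succ']
    exact peirce_inv_mem_cone hp h1 ih

/-- The operator is `exp(s L_p)`, the limit of `(1 - (s/n) L_p)^{-n}`; these resolvents are positive
once `s < n`, and the cone is closed. -/
theorem peirce_exp_mem_cone (hp : p * p = p) (s : ℝ) {z : V} (hz : z ∈ cone V) :
    peirce p (Real.exp s) (Real.exp (s / 2)) z ∈ cone V := by
  have hlim : ∀ s : ℝ, Filter.Tendsto (fun n : ℕ => ((1 - s / n)⁻¹) ^ n) Filter.atTop
      (nhds (Real.exp s)) := by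
    intro s
    have := (Real.tendsto_one_add_div_pow_exp (-s)).inv₀ (Real.exp_ne_zero _)
    rw [← Real.exp_neg, neg_neg] at this
    refine this.congr fun n => ?_
    rw [inv_pow, neg_div, ← sub_eq_add_neg]
  have hlim2 : Filter.Tendsto (fun n : ℕ => ((1 - s / n / 2)⁻¹) ^ n) Filter.atTop
      (nhds (Real.exp (s / 2))) := by
    refine (hlim (s / 2)).congr fun n => ?_
    rw [div_right_comm]
  have hcont : Continuous fun q : ℝ × ℝ => peirce p q.1 q.2 z := by
    simp only [peirce_apply]
    fun_prop
  have ht := (hcont.tendsto (Real.exp s, Real.exp (s / 2))).comp ((hlim s).prodMk_nhds hlim2)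
  refine isClosed_cone.mem_of_tendsto ht ?_
  filter_upwards [Filter.eventually_gt_atTop (max 0 ⌈s⌉₊)] with n hn
  have hn0 : 0 < n := lt_of_le_of_lt (le_max_left _ _) hn
  have hs : s / n < 1 := by
    rw [div_lt_one (by exact_mod_cast hn0)]
    exact Nat.lt_of_ceil_lt (lt_of_le_of_lt (le_max_right _ _) hn)
  simp only [Function.comp_apply]
  rw [← peirce_pow hp]
  exact peirce_inv_pow_mem_cone hp hs n hz

theorem peirce_sq_mem_cone (hp : p * p = p) {t : ℝ} (ht : 0 < t) {z : V} (hz : z ∈ cone V) :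
    peirce p (t * t) t z ∈ cone V := by
  have := peirce_exp_mem_cone hp (Real.log t + Real.log t) hz
  rwa [add_self_div_two, Real.exp_add, Real.exp_log ht] at this

theorem peirce_mul_one_part (hp : p * p = p) (s t : ℝ) :
    peirce p s t * ((2 : ℝ) • (L V p * L V p) - L V p) =
      s • ((2 : ℝ) • (L V p * L V p) - L V p) := by
  have h3 := L_idempotent_cubic hp
  have h4 := congrArg (fun T => T * L V p) h3
  simp only [smul_mul_assoc, _root_.sub_mul, mul_assoc] at h4 h3
  simp only [peirce, _root_.add_mul, _root_.mul_sub, smul_mul_assoc, mul_smul_comm, mul_assoc,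
    MulOneClass.one_mul]
  linear_combination (norm := module) (4 * t - s - 3) • h3 + (2 * s - 4 * t + 2) • (h4 + h3)

theorem peirce_mul_half_part (hp : p * p = p) (hc : p * c = 0) (s t : ℝ) :
    peirce p s t * (L V p * L V c) = t • (L V p * L V c) := by
  have h1 := L_mul_L_eq_of_mul_eq_zero hp hc
  have h2 := congrArg (fun T => L V p * T) h1
  simp only [mul_smul_comm, mul_assoc] at h1 h2
  simp only [peirce, _root_.add_mul, smul_mul_assoc, mul_assoc, MulOneClass.one_mul]
  linear_combination (norm := module)
    (-(4 * t - s - 3) / 2 - (2 * s - 4 * t + 2) / 4) • h1 - ((2 * s - 4 * t + 2) / 2) • h2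

theorem peirce_mul_zero_part (hp : p * p = p) (hc : p * c = 0) (s t : ℝ) :
    peirce p s t * ((2 : ℝ) • (L V c * L V c) - L V (c * c)) =
      (2 : ℝ) • (L V c * L V c) - L V (c * c) := by
  have c1 := commute_L_of_mul_eq_zero hp hc
  have c2 := commute_L_of_mul_eq_zero hp (mul_mul_idempotent_eq_zero hp hc)
  have h1 := L_sq_mul_L_of_mul_eq_zero hp hc
  rw [← c2.eq, ← (c1.mul_right c1).eq] at h1
  have h2 := congrArg (fun T => L V p * T) h1
  simp only [mul_smul_comm] at h1 h2
  simp only [peirce, _root_.add_mul, _root_.mul_sub, smul_mul_assoc, mul_smul_comm, mul_assoc,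
    MulOneClass.one_mul]
  linear_combination (norm := module) -(4 * t - s - 3) • h1 - (2 * s - 4 * t + 2) • h2

/-- `U_{c+tp}` is `t²`, `t` and `1` times three fixed operators with ranges in the `1`-, `1/2`- and
`0`-Peirce spaces of `p`; `peirce p (t * t) t` produces exactly these factors. -/
theorem quadRepLin_add_smul (hp : p * p = p) (hc : p * c = 0) (t : ℝ) :
    quadRepLin (c + t • p) = peirce p (t * t) t * quadRepLin (c + p) := by
  have hexp : ∀ t : ℝ, quadRepLin (c + t • p) = (t * t) • ((2 : ℝ) • (L V p * L V p) - L V p) +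
      (4 * t) • (L V p * L V c) + ((2 : ℝ) • (L V c * L V c) - L V (c * c)) := by
    intro t
    have e : (c + t • p) * (c + t • p) = c * c + (t * t) • p := by
      rw [mul_add, add_mul, add_mul, smul_mul', mul_smul', mul_smul', smul_mul', hc, mul_comm c p,
        hc, hp, smul_smul]
      simp
    rw [quadRepLin, e, map_add, map_add, map_smul, map_smul, _root_.mul_add, _root_.add_mul,
      _root_.add_mul, smul_mul_assoc, mul_smul_comm, mul_smul_comm, smul_mul_assoc,
      (commute_L_of_mul_eq_zero hp hc).eq]
    module
  have h1 := hexp 1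
  rw [one_smul] at h1
  rw [hexp t, h1, _root_.mul_add, _root_.mul_add, mul_smul_comm, mul_smul_comm,
    peirce_mul_one_part hp, peirce_mul_half_part hp hc, peirce_mul_zero_part hp hc]
  module

theorem commute_L_quadRepLin_add (hp : p * p = p) (hc : p * c = 0) :
    Commute (L V p) (quadRepLin (c + p)) := by
  have e : (c + p) * (c + p) = c * c + p := by
    rw [mul_add, add_mul, add_mul, mul_comm c p, hc, hp]
    simp
  have c1 := commute_L_of_mul_eq_zero hp hc
  have c2 := commute_L_of_mul_eq_zero hp (mul_mul_idempotent_eq_zero hp hc)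
  have c0 : Commute (L V p) (L V p) := Commute.refl _
  rw [quadRepLin, e, map_add, map_add]
  exact (((c1.add_right c0).mul_right (c1.add_right c0)).smul_right _).sub_right (c2.add_right c0)

theorem IsJordanFrame.exists_add_eq {n : ℕ} {q : Fin n → V} (hq : IsJordanFrame q)
    (a : Fin n → ℝ) (j : Fin n) : ∃ c : V, q j * c = 0 ∧
      ∀ t, ∑ i, Function.update a j t i • q i = c + t • q j := by
  classical
  refine ⟨∑ i ∈ Finset.univ.erase j, a i • q i, ?_, fun t => ?_⟩
  · rw [Finset.mul_sum]
    refine Finset.sum_eq_zero fun i hi => ?_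
    rw [mul_smul', hq.orthogonal j i (Finset.ne_of_mem_erase hi).symm, smul_zero]
  · rw [← Finset.sum_erase_add _ _ (Finset.mem_univ j), Function.update_self]
    congr 1
    refine Finset.sum_congr rfl fun i hi => ?_
    rw [Function.update_of_ne (Finset.ne_of_mem_erase hi)]

theorem quadRepLin_one : quadRepLin (1 : V) = 1 := by
  rw [quadRepLin, one_mul, L_one, MulOneClass.mul_one]
  module

/-- The eigenvalues are switched from `1` to `a i` one at a time. Each switch multiplies `U` by a
positive Peirce operator and the `U` of the inverse by the inverse Peirce operator, which commutes
past and cancels. -/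
theorem IsJordanFrame.quadRepLin_sum_aux {n : ℕ} {q : Fin n → V} (hq : IsJordanFrame q)
    {a : Fin n → ℝ} (ha : ∀ i, 0 < a i) (S : Finset (Fin n)) :
    ∀ b : Fin n → ℝ, (∀ i, b i = if i ∈ S then a i else 1) →
    (∀ z ∈ cone V, quadRepLin (∑ i, b i • q i) z ∈ cone V) ∧
      quadRepLin (∑ i, (b i)⁻¹ • q i) * quadRepLin (∑ i, b i • q i) = 1 := by
  classical
  induction S using Finset.induction_on with
  | empty =>
    intro b hb
    have hb' : b = fun _ => 1 := funext fun i => by simp [hb]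
    subst hb'
    simp [hq.sum_eq_one, quadRepLin_one]
  | insert j S hj ih =>
    intro b hb
    have hbj : b j = a j := by simp [hb]
    have hupd : b = Function.update (Function.update b j 1) j (a j) := by
      rw [Function.update_idem, ← hbj, Function.update_eq_self]
    have hinv : (fun i => (b i)⁻¹) = Function.update (fun i => (b i)⁻¹) j (a j)⁻¹ := by
      rw [← hbj, Function.update_eq_self j (fun i => (b i)⁻¹)]
    obtain ⟨h1, h2⟩ := ih (Function.update b j 1) fun i => by
      by_cases hij : i = j
      · subst hij; simp [hj]
      · rw [Function.update_of_ne hij, hb]; simp [hij]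
    obtain ⟨c, hc, hcs⟩ := hq.exists_add_eq b j
    obtain ⟨c', hc', hcs'⟩ := hq.exists_add_eq (fun i => (b i)⁻¹) j
    have e1 := hcs 1
    have e2 := hcs' 1
    have e3 : (fun i => (Function.update b j 1 i)⁻¹) = Function.update (fun i => (b i)⁻¹) j 1 := by
      funext i
      by_cases hij : i = j
      · subst hij; simp
      · simp [Function.update_of_ne hij]
    have e4 := hcs (a j)
    have e5 := hcs' (a j)⁻¹
    rw [← hbj, Function.update_eq_self] at e4
    rw [← hinv] at e5
    simp only [one_smul] at e1 e2
    have e6 : ∑ i, (Function.update b j 1 i)⁻¹ • q i = c' + q j := by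
      rw [← e2, ← e3]
    rw [e1] at h1
    rw [e1, e6] at h2
    rw [e4, e5, hbj, quadRepLin_add_smul (hq.idempotent j) hc,
      quadRepLin_add_smul (hq.idempotent j) hc']
    refine ⟨fun z hz => peirce_sq_mem_cone (hq.idempotent j) (ha j) (h1 z hz), ?_⟩
    have hcomm := commute_L_quadRepLin_add (hq.idempotent j) hc'
    have hcomm' : ∀ s t, Commute (peirce (q j) s t) (quadRepLin (c' + q j)) := fun s t =>
      ((Commute.one_left _).add_left (hcomm.smul_left _)).add_left
        ((hcomm.mul_left hcomm).smul_left _)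
    rw [(hcomm' _ _).eq, mul_assoc, ← mul_assoc (peirce _ _ _), peirce_mul_peirce (hq.idempotent j),
      inv_mul_cancel₀ (ha j).ne', mul_mul_mul_comm, inv_mul_cancel₀ (ha j).ne',
      MulOneClass.mul_one, peirce_one_one, MulOneClass.one_mul, h2]

theorem IsJordanFrame.quadRep_mem_cone {n : ℕ} {q : Fin n → V} (hq : IsJordanFrame q)
    {a : Fin n → ℝ} (ha : ∀ i, 0 < a i) {z : V} (hz : z ∈ cone V) :
    quadRep (∑ i, a i • q i) z ∈ cone V :=
  (hq.quadRepLin_sum_aux ha Finset.univ a fun i => by simp).1 z hz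

theorem IsJordanFrame.quadRep_inv_quadRep {n : ℕ} {q : Fin n → V} (hq : IsJordanFrame q)
    {a : Fin n → ℝ} (ha : ∀ i, 0 < a i) (z : V) :
    quadRep (∑ i, (a i)⁻¹ • q i) (quadRep (∑ i, a i • q i) z) = z :=
  DFunLike.congr_fun (hq.quadRepLin_sum_aux ha Finset.univ a fun i => by simp).2 z

end QuadraticRepresentation

/-! ### The functions `M` and `m`, and the Finsler seminorm -/

section Order

variable {V : Type*} [EuclideanJordanAlgebra V]

theorem exists_smul_one_sub_mem_cone (x : V) : ∃ N > 0, (N : ℝ) • (1 : V) - x ∈ cone V := by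
  obtain ⟨n, p, lam, hp, rfl⟩ := exists_jordanFrame x
  refine ⟨1 + ∑ i, |lam i|, by positivity, ?_⟩
  rw [← neg_sub, hp.sum_smul_sub_smul_one, ← Finset.sum_neg_distrib]
  simp only [← neg_smul]
  refine hp.sum_smul_mem_cone_iff.2 fun i => ?_
  have h1 := Finset.single_le_sum (f := fun i => |lam i|) (fun i _ => abs_nonneg _)
    (Finset.mem_univ i)
  have h2 := le_abs_self (lam i)
  linarith

theorem add_mem_interior_cone {x y : V} (hx : x ∈ cone V) (hy : y ∈ interior (cone V)) :
    x + y ∈ interior (cone V) := by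
  obtain ⟨ε, hε, h⟩ := mem_interior_cone_iff.1 hy
  refine mem_interior_cone_iff.2 ⟨ε, hε, ?_⟩
  rw [add_sub_assoc]
  exact add_mem_cone hx h

theorem smul_mem_interior_cone {c : ℝ} (hc : 0 < c) {x : V} (hx : x ∈ interior (cone V)) :
    c • x ∈ interior (cone V) := by
  obtain ⟨ε, hε, h⟩ := mem_interior_cone_iff.1 hx
  refine mem_interior_cone_iff.2 ⟨c * ε, by positivity, ?_⟩
  rw [mul_smul, ← smul_sub]
  exact smul_mem_cone hc.le h

theorem smul_mem_cone_iff {c : ℝ} (hc : 0 < c) {x : V} : c • x ∈ cone V ↔ x ∈ cone V := by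
  refine ⟨fun h => ?_, smul_mem_cone hc.le⟩
  have := smul_mem_cone (inv_pos.2 hc).le h
  rwa [inv_smul_smul₀ hc.ne'] at this

theorem inner_idempotent_pos {z p : V} (hz : z ∈ interior (cone V)) (hp : p * p = p)
    (hp0 : p ≠ 0) : 0 < inner ℝ z p := by
  obtain ⟨ε, hε, h⟩ := mem_interior_cone_iff.1 hz
  have h1 := inner_nonneg_of_mem_cone h (mem_cone_of_idempotent hp)
  have e : inner ℝ 1 p = ‖p‖ ^ 2 := by
    rw [real_inner_comm]
    conv_lhs => rw [← hp, ← inner_eq_inner_mul_one, real_inner_self_eq_norm_sq]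
  rw [inner_sub_left, inner_smul_left, e, conj_trivial] at h1
  have : 0 < ‖p‖ ^ 2 := by
    have := norm_pos_iff.2 hp0
    positivity
  nlinarith

variable {x y : V}

/-- The admissible `β` form a closed set, bounded below by pairing with `1`, so the infimum is
attained. In the zero space every `β` is admissible and `sInf` is a default value, which
`Nontrivial` excludes. -/
theorem upperM_le_iff [Nontrivial V] (hy : y ∈ interior (cone V)) {β : ℝ} :
    upperM x y ≤ β ↔ β • y - x ∈ cone V := by
  have hy1 : 0 < inner ℝ y (1 : V) := inner_idempotent_pos hy (one_mul 1) one_ne_zero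
  have hbdd : BddBelow {β : ℝ | β • y - x ∈ cone V} := by
    refine ⟨inner ℝ x 1 / inner ℝ y (1 : V), fun b hb => ?_⟩
    have h := inner_nonneg_of_mem_cone hb one_mem_cone
    rw [inner_sub_left, inner_smul_left, conj_trivial] at h
    rw [div_le_iff₀ hy1]
    linarith
  have hne : {β : ℝ | β • y - x ∈ cone V}.Nonempty := by
    obtain ⟨ε, hε, h⟩ := mem_interior_cone_iff.1 hy
    obtain ⟨N, hN, h'⟩ := exists_smul_one_sub_mem_cone x
    refine ⟨N / ε, ?_⟩
    have : (N / ε) • y - x = (N / ε) • (y - ε • (1 : V)) + (N • (1 : V) - x) := by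
      rw [smul_sub, smul_smul, div_mul_cancel₀ _ hε.ne']
      abel
    rw [Set.mem_ofPred_eq, this]
    exact add_mem_cone (smul_mem_cone (by positivity) h) h'
  have hclosed : IsClosed {β : ℝ | β • y - x ∈ cone V} :=
    isClosed_cone.preimage (by fun_prop : Continuous fun β : ℝ => β • y - x)
  constructor
  · intro h
    have hmem : upperM x y • y - x ∈ cone V := hclosed.csInf_mem hne hbdd
    have : β • y - x = (upperM x y • y - x) + (β - upperM x y) • y := by
      module
    rw [this]
    exact add_mem_cone hmem (smul_mem_cone (by linarith) (interior_subset hy))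
  · exact fun h => csInf_le hbdd h

theorem upperM_lt_iff [Nontrivial V] (hy : y ∈ interior (cone V)) {β : ℝ} :
    upperM x y < β ↔ β • y - x ∈ interior (cone V) := by
  constructor
  · intro h
    have : β • y - x = (upperM x y • y - x) + (β - upperM x y) • y := by
      module
    rw [this]
    exact add_mem_interior_cone ((upperM_le_iff hy).1 le_rfl)
      (smul_mem_interior_cone (by linarith) hy)
  · intro h
    obtain ⟨ε, hε, h⟩ := mem_interior_cone_iff.1 h
    obtain ⟨N, hN, h'⟩ := exists_smul_one_sub_mem_cone y
    have hle : upperM x y ≤ β - ε / N := by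
      rw [upperM_le_iff hy]
      have : (β - ε / N) • y - x =
          (β • y - x - ε • (1 : V)) + (ε / N) • (N • (1 : V) - y) := by
        rw [smul_sub, smul_smul, div_mul_cancel₀ _ hN.ne']
        module
      rw [this]
      exact add_mem_cone h (smul_mem_cone (by positivity) h')
    have : 0 < ε / N := by positivity
    linarith

theorem lowerM_eq_neg_upperM : lowerM x y = -upperM (-x) y := by
  rw [lowerM, upperM, Real.sInf_def, neg_neg]
  congr 1
  ext α
  simp only [Set.mem_ofPred_eq, Set.mem_neg, sub_neg_eq_add, neg_smul]
  rw [sub_eq_neg_add]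

theorem le_lowerM_iff [Nontrivial V] (hy : y ∈ interior (cone V)) {α : ℝ} :
    α ≤ lowerM x y ↔ x - α • y ∈ cone V := by
  rw [lowerM_eq_neg_upperM, le_neg, upperM_le_iff hy, neg_smul, sub_neg_eq_add, sub_eq_neg_add]

theorem isOpen_univ_prod_interior_cone : IsOpen ((Set.univ : Set V) ×ˢ interior (cone V)) :=
  isOpen_univ.prod isOpen_interior

/-- Semicontinuity from both sides: `M ≤ a` is a condition of membership in the closed cone, `M < a`
one of membership in its interior. -/
theorem continuousOn_upperM [Nontrivial V] :
    ContinuousOn (fun q : V × V => upperM q.1 q.2) (Set.univ ×ˢ interior (cone V)) := by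
  rintro ⟨x, y⟩ ⟨-, hy⟩
  refine ContinuousAt.continuousWithinAt (tendsto_order.2 ⟨fun a ha => ?_, fun a ha => ?_⟩)
  · have hopen : IsOpen {q : V × V | a • q.2 - q.1 ∉ cone V} :=
      (isClosed_cone.preimage
        (by fun_prop : Continuous fun q : V × V => a • q.2 - q.1)).isOpen_compl
    have hmem : a • y - x ∉ cone V := fun h => absurd ((upperM_le_iff hy).2 h) (not_le.2 ha)
    filter_upwards [hopen.mem_nhds (show (x, y) ∈ {q : V × V | a • q.2 - q.1 ∉ cone V} from hmem),
      isOpen_univ_prod_interior_cone.mem_nhds (show (x, y) ∈ _ from ⟨Set.mem_univ _, hy⟩)] with q hq1 hq2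
    exact not_le.1 fun h => hq1 ((upperM_le_iff hq2.2).1 h)
  · have hopen : IsOpen {q : V × V | a • q.2 - q.1 ∈ interior (cone V)} :=
      isOpen_interior.preimage (by fun_prop : Continuous fun q : V × V => a • q.2 - q.1)
    have hmem : a • y - x ∈ interior (cone V) := (upperM_lt_iff hy).1 ha
    filter_upwards [hopen.mem_nhds
        (show (x, y) ∈ {q : V × V | a • q.2 - q.1 ∈ interior (cone V)} from hmem),
      isOpen_univ_prod_interior_cone.mem_nhds (show (x, y) ∈ _ from ⟨Set.mem_univ _, hy⟩)] with q hq1 hq2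
    exact (upperM_lt_iff hq2.2).2 hq1

theorem finslerNorm_eq (w x : V) : finslerNorm w x = upperM x w + upperM (-x) w := by
  rw [finslerNorm, lowerM_eq_neg_upperM, sub_neg_eq_add]

theorem continuousOn_finslerNorm [Nontrivial V] :
    ContinuousOn (fun q : V × V => finslerNorm q.1 q.2) (interior (cone V) ×ˢ Set.univ) := by
  simp only [finslerNorm_eq]
  refine ContinuousOn.add
    (continuousOn_upperM.comp (f := fun q : V × V => (q.2, q.1)) (by fun_prop) ?_)
    (continuousOn_upperM.comp (f := fun q : V × V => (-q.2, q.1)) (by fun_prop) ?_)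
  · exact fun q hq => ⟨Set.mem_univ _, hq.1⟩
  · exact fun q hq => ⟨Set.mem_univ _, hq.1⟩

theorem upperM_smul_add_smul [Nontrivial V] {w : V} (hw : w ∈ interior (cone V)) {c : ℝ} (hc : 0 < c) (a : ℝ) :
    upperM (a • w + c • x) (c • w) = upperM x w + a / c := by
  refine eq_of_forall_ge_iff fun β => ?_
  rw [upperM_le_iff (smul_mem_interior_cone hc hw), ← le_sub_iff_add_le, upperM_le_iff hw,
    ← smul_mem_cone_iff hc (x := (β - a / c) • w - x)]
  have : c • ((β - a / c) • w - x) = β • c • w - (a • w + c • x) := by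
    rw [smul_sub, smul_smul, mul_sub, mul_div_cancel₀ _ hc.ne']
    module
  rw [this]

/-- The seminorm is invariant under rescaling of a path. -/
theorem finslerNorm_smul_add_smul [Nontrivial V] {w : V} (hw : w ∈ interior (cone V)) {c : ℝ} (hc : 0 < c)
    (a : ℝ) : finslerNorm (c • w) (a • w + c • x) = finslerNorm w x := by
  have : -(a • w + c • x) = (-a) • w + c • (-x) := by module
  rw [finslerNorm_eq, finslerNorm_eq, this, upperM_smul_add_smul hw hc, upperM_smul_add_smul hw hc]
  ring

theorem quadRep_sub (a x y : V) : quadRep a (x - y) = quadRep a x - quadRep a y :=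
  map_sub (quadRepLin a) x y

theorem quadRep_smul (a : V) (c : ℝ) (x : V) : quadRep a (c • x) = c • quadRep a x :=
  map_smul (quadRepLin a) c x

theorem quadRep_one (a : V) : quadRep a 1 = a * a := by
  rw [quadRep, mul_one, mul_one, two_smul]
  abel

namespace IsJordanFrame

variable {n : ℕ} {q : Fin n → V}

theorem quadRep_mem_cone_iff (hq : IsJordanFrame q) {a : Fin n → ℝ} (ha : ∀ i, 0 < a i) {z : V} :
    quadRep (∑ i, a i • q i) z ∈ cone V ↔ z ∈ cone V := by
  refine ⟨fun h => ?_, hq.quadRep_mem_cone ha⟩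
  rw [← hq.quadRep_inv_quadRep ha z]
  exact hq.quadRep_mem_cone (fun i => inv_pos.2 (ha i)) h

theorem quadRep_mem_interior (hq : IsJordanFrame q) {a : Fin n → ℝ} (ha : ∀ i, 0 < a i) {z : V}
    (hz : z ∈ interior (cone V)) : quadRep (∑ i, a i • q i) z ∈ interior (cone V) := by
  obtain ⟨ε, hε, h⟩ := mem_interior_cone_iff.1 hz
  have h1 := hq.quadRep_mem_cone ha h
  rw [quadRep_sub, quadRep_smul, quadRep_one, hq.sum_mul_sum] at h1
  have h2 := smul_mem_interior_cone hε
    (hq.sum_smul_mem_interior_iff.2 fun i => mul_pos (ha i) (ha i))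
  simpa using add_mem_interior_cone h1 h2

theorem upperM_quadRep (hq : IsJordanFrame q) {a : Fin n → ℝ} (ha : ∀ i, 0 < a i) (x y : V) :
    upperM (quadRep (∑ i, a i • q i) x) (quadRep (∑ i, a i • q i) y) = upperM x y := by
  simp only [upperM, ← quadRep_smul, ← quadRep_sub, hq.quadRep_mem_cone_iff ha]

theorem lowerM_quadRep (hq : IsJordanFrame q) {a : Fin n → ℝ} (ha : ∀ i, 0 < a i) (x y : V) :
    lowerM (quadRep (∑ i, a i • q i) x) (quadRep (∑ i, a i • q i) y) = lowerM x y := by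
  simp only [lowerM, ← quadRep_smul, ← quadRep_sub, hq.quadRep_mem_cone_iff ha]

theorem upperM_sum [Nontrivial V] (hq : IsJordanFrame q) {a b : Fin n → ℝ} (hb : ∀ i, 0 < b i) {j : Fin n}
    (hj : ∀ i, a i / b i ≤ a j / b j) :
    upperM (∑ i, a i • q i) (∑ i, b i • q i) = a j / b j := by
  refine eq_of_forall_ge_iff fun β => ?_
  rw [upperM_le_iff (hq.sum_smul_mem_interior_iff.2 hb), Finset.smul_sum,
    ← Finset.sum_sub_distrib]
  simp only [smul_smul, ← sub_smul]
  rw [hq.sum_smul_mem_cone_iff]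
  constructor
  · intro h
    rw [div_le_iff₀ (hb j)]
    linarith [h j]
  · intro h i
    have := (hj i).trans h
    rw [div_le_iff₀ (hb i)] at this
    linarith

theorem lowerM_sum [Nontrivial V] (hq : IsJordanFrame q) {a b : Fin n → ℝ} (hb : ∀ i, 0 < b i) {j : Fin n}
    (hj : ∀ i, a j / b j ≤ a i / b i) :
    lowerM (∑ i, a i • q i) (∑ i, b i • q i) = a j / b j := by
  have := hq.upperM_sum (a := fun i => -a i) hb (j := j) fun i => by
    rw [neg_div, neg_div]; exact neg_le_neg (hj i)
  rw [lowerM_eq_neg_upperM, ← Finset.sum_neg_distrib]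
  simp only [← neg_smul]
  rw [this, neg_div, neg_neg]

end IsJordanFrame

/-- The bound `M(x/y)` is attained at a nonzero idempotent. -/
theorem exists_idempotent_inner_eq_upperM [Nontrivial V] (x : V) (hy : y ∈ interior (cone V)) :
    ∃ p : V, p * p = p ∧ p ≠ 0 ∧ inner ℝ x p = upperM x y * inner ℝ y p := by
  have hmem := (upperM_le_iff (x := x) hy).1 le_rfl
  -- `M(x/y) y - x` is a boundary point of the cone, so it has a zero eigenvalue; its idempotent is
  -- the required one.
  have hint : upperM x y • y - x ∉ interior (cone V) := fun h =>
    absurd ((upperM_lt_iff hy).2 h) (lt_irrefl _)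
  obtain ⟨n, p, lam, hp, hw⟩ := exists_jordanFrame (upperM x y • y - x)
  rw [hw] at hmem hint
  rw [hp.sum_smul_mem_cone_iff] at hmem
  rw [hp.sum_smul_mem_interior_iff] at hint
  push Not at hint
  obtain ⟨i, hi⟩ := hint
  have hi0 : lam i = 0 := le_antisymm hi (hmem i)
  have h := congrArg (fun v => inner ℝ v (p i)) hw
  simp only [hp.inner_sum_smul, hi0, inner_sub_left, inner_smul_left, conj_trivial,
    MulZeroClass.zero_mul] at h
  exact ⟨p i, hp.idempotent i, hp.ne_zero i, by linarith⟩

theorem exists_idempotent_inner_eq_lowerM [Nontrivial V] (x : V) (hy : y ∈ interior (cone V)) :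
    ∃ p : V, p * p = p ∧ p ≠ 0 ∧ inner ℝ x p = lowerM x y * inner ℝ y p := by
  obtain ⟨p, hp, hp0, h⟩ := exists_idempotent_inner_eq_upperM (-x) hy
  refine ⟨p, hp, hp0, ?_⟩
  rw [inner_neg_left] at h
  rw [lowerM_eq_neg_upperM]
  linarith

end Order

/-! ### Integrability of speed and the lower bound on length -/

section Paths

open MeasureTheory

variable {V : Type*} [EuclideanJordanAlgebra V] {x y : V} {γ : ℝ → V}

theorem exists_mem_Ioo_of_notMem_range {t : ℕ → ℝ} {s : ℝ} (hs : s ∉ Set.range t) (h0 : t 0 < s) :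
    ∀ k : ℕ, s < t k → ∃ i < k, s ∈ Set.Ioo (t i) (t (i + 1)) := by
  intro k
  induction k with
  | zero => exact fun h => absurd h (not_lt.2 h0.le)
  | succ k ih =>
    intro h
    rcases lt_trichotomy s (t k) with h1 | h1 | h1
    · obtain ⟨i, hi, hmem⟩ := ih h1
      exact ⟨i, by omega, hmem⟩
    · exact absurd ⟨k, h1.symm⟩ hs
    · exact ⟨k, by omega, h1, h⟩

theorem le_of_forall_lt_succ {t : ℕ → ℝ} {k : ℕ} (ht : ∀ i < k, t i < t (i + 1)) {i j : ℕ}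
    (hij : i ≤ j) (hj : j ≤ k) : t i ≤ t j := by
  induction j, hij using Nat.le_induction with
  | base => exact le_rfl
  | succ j hij ih => exact (ih (by omega)).trans (ht j (by omega)).le

theorem IsPath.exists_countable (hγ : IsPath x y γ) :
    ∃ S : Set ℝ, S.Countable ∧ ∀ s ∈ Set.Ioo (0 : ℝ) 1 \ S, DifferentiableAt ℝ γ s := by
  obtain ⟨-, -, -, -, k, t, h0, h1, -, hC⟩ := hγ
  refine ⟨Set.range t, Set.countable_range t, fun s hs => ?_⟩
  obtain ⟨i, hi, hmem⟩ := exists_mem_Ioo_of_notMem_range hs.2 (by rw [h0]; exact hs.1.1) k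
    (by rw [h1]; exact hs.1.2)
  exact ((hC i hi).differentiableOn one_ne_zero).differentiableAt (Icc_mem_nhds hmem.1 hmem.2)

/-- A continuous expression in position and velocity is integrable along a piecewise `C¹` path. -/
theorem IsPath.intervalIntegrable (hγ : IsPath x y γ) {F : V × V → ℝ}
    (hF : ContinuousOn F (interior (cone V) ×ˢ Set.univ)) :
    IntervalIntegrable (fun t => F (γ t, deriv γ t)) volume 0 1 := by
  obtain ⟨-, -, hdom, hcont, k, t, h0, h1, hlt, hC⟩ := hγ
  rw [← h0, ← h1]
  refine IntervalIntegrable.trans_iterate fun i hi => ?_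
  have hle := (hlt i hi).le
  have hsub : Set.Icc (t i) (t (i + 1)) ⊆ Set.Icc 0 1 := by
    apply Set.Icc_subset_Icc
    · rw [← h0]; exact le_of_forall_lt_succ hlt (Nat.zero_le i) hi.le
    · rw [← h1]; exact le_of_forall_lt_succ hlt hi le_rfl
  -- On each piece the one-sided derivative is continuous up to the endpoints and agrees with
  -- `deriv` inside.
  have hd := (hC i hi).continuousOn_derivWithin (uniqueDiffOn_Icc (hlt i hi)) le_rfl
  have hcG : ContinuousOn (fun s => F (γ s, derivWithin γ (Set.Icc (t i) (t (i + 1))) s))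
      (Set.Icc (t i) (t (i + 1))) :=
    hF.comp ((hcont.mono hsub).prodMk hd) fun s hs => ⟨(hdom s (hsub hs)).1, Set.mem_univ _⟩
  rw [← Set.uIcc_of_le hle] at hcG
  refine hcG.intervalIntegrable.congr_uIoo fun s hs => ?_
  rw [Set.uIoo_of_le hle] at hs
  simp only [Set.uIcc_of_le hle, derivWithin_of_mem_nhds (Icc_mem_nhds hs.1 hs.2)]

theorem IsPath.intervalIntegrable_speed [Nontrivial V] (hγ : IsPath x y γ) :
    IntervalIntegrable (speed γ) volume 0 1 :=
  hγ.intervalIntegrable continuousOn_finslerNorm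

theorem IsPath.hilbertDist_le_length [Nontrivial V] (hγ : IsPath x y γ) :
    hilbertDist x y ≤ length γ := by
  obtain ⟨hγ0, hγ1, hdom, hcont, -⟩ := id hγ
  have hx : x ∈ interior (cone V) := hγ0 ▸ (hdom 0 ⟨le_rfl, zero_le_one⟩).1
  have hy : y ∈ interior (cone V) := hγ1 ▸ (hdom 1 ⟨zero_le_one, le_rfl⟩).1
  obtain ⟨p, hp, hp0, hM⟩ := exists_idempotent_inner_eq_upperM x hy
  obtain ⟨q, hq, hq0, hm⟩ := exists_idempotent_inner_eq_lowerM x hy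
  have hpos : ∀ {z e : V}, z ∈ interior (cone V) → e * e = e → e ≠ 0 → 0 < inner ℝ z e :=
    fun hz he he0 => inner_idempotent_pos hz he he0
  have hMpos : 0 < upperM x y :=
    pos_of_mul_pos_left (hM ▸ hpos hx hp hp0) (hpos hy hp hp0).le
  have hmpos : 0 < lowerM x y :=
    pos_of_mul_pos_left (hm ▸ hpos hx hq hq0) (hpos hy hq hq0).le
  -- Since `M(x/y) = ⟨x,p⟩ / ⟨y,p⟩` and `m(x/y) = ⟨x,q⟩ / ⟨y,q⟩`, the increment of `f` over `[0,1]`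
  -- is `log (M/m)`.
  set f : ℝ → ℝ := fun t => Real.log (inner ℝ (γ t) q) - Real.log (inner ℝ (γ t) p) with hf
  set f' : ℝ → ℝ := fun t => inner ℝ (deriv γ t) q / inner ℝ (γ t) q -
    inner ℝ (deriv γ t) p / inner ℝ (γ t) p with hf'
  have hfi : IntervalIntegrable f' volume 0 1 := by
    refine hγ.intervalIntegrable
      (F := fun v => inner ℝ v.2 q / inner ℝ v.1 q - inner ℝ v.2 p / inner ℝ v.1 p) ?_
    refine ContinuousOn.sub (ContinuousOn.div (by fun_prop) (by fun_prop) fun v hv => ?_)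
      (ContinuousOn.div (by fun_prop) (by fun_prop) fun v hv => ?_)
    · exact (hpos hv.1 hq hq0).ne'
    · exact (hpos hv.1 hp hp0).ne'
  obtain ⟨S, hS, hdiff⟩ := hγ.exists_countable
  have hftc : ∫ t in (0 : ℝ)..1, f' t = f 1 - f 0 := by
    refine integral_eq_of_hasDerivAt_off_countable f f' hS ?_ ?_ hfi
    · rw [Set.uIcc_of_le zero_le_one]
      refine ContinuousOn.sub (ContinuousOn.log (by fun_prop) fun t ht => ?_)
        (ContinuousOn.log (by fun_prop) fun t ht => ?_)
      · exact (hpos (hdom t ht).1 hq hq0).ne'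
      · exact (hpos (hdom t ht).1 hp hp0).ne'
    · rw [min_eq_left zero_le_one, max_eq_right zero_le_one]
      intro t ht
      have hd := (hdiff t ht).hasDerivAt
      have hγt := (hdom t (Set.Ioo_subset_Icc_self ht.1)).1
      have hin : ∀ e : V, HasDerivAt (fun s => inner ℝ (γ s) e) (inner ℝ (deriv γ t) e) t :=
        fun e => by simpa using hd.inner ℝ (hasDerivAt_const t e)
      exact ((hin q).log (hpos hγt hq hq0).ne').sub ((hin p).log (hpos hγt hp hp0).ne')
  have hval : hilbertDist x y = f 1 - f 0 := by
    simp only [hf, hγ0, hγ1]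
    rw [hilbertDist, Real.log_div hMpos.ne' hmpos.ne', hM, hm,
      Real.log_mul hMpos.ne' (hpos hy hp hp0).ne', Real.log_mul hmpos.ne' (hpos hy hq hq0).ne']
    ring
  rw [hval, ← hftc, length]
  refine intervalIntegral.integral_mono_on_of_le_Ioo zero_le_one hfi hγ.intervalIntegrable_speed
    fun t ht => ?_
  have hγt := (hdom t (Set.Ioo_subset_Icc_self ht)).1
  have h1 := inner_nonneg_of_mem_cone ((upperM_le_iff (x := deriv γ t) hγt).1 le_rfl)
    (mem_cone_of_idempotent hq)
  have h2 := inner_nonneg_of_mem_cone ((le_lowerM_iff (x := deriv γ t) hγt).1 le_rfl)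
    (mem_cone_of_idempotent hp)
  rw [inner_sub_left, inner_smul_left, conj_trivial, sub_nonneg] at h1 h2
  rw [speed, finslerNorm]
  exact sub_le_sub ((div_le_iff₀ (hpos hγt hq hq0)).2 h1) ((le_div_iff₀ (hpos hγt hp hp0)).2 h2)

theorem normTrace_eq (z : V) : normTrace z = (1 / (rank V : ℝ)) * traceForm V z := by
  rw [normTrace, trace_eq_traceForm]

/-- If `rank V` were `0`, then `1 / 0 = 0` would give `φ = 0`, contradicting `φ(x) = 1`. This makes
a separate bound on frame sizes unnecessary. -/
theorem rank_pos_of_mem_domain (hx : x ∈ domain V) : 0 < (rank V : ℝ) := by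
  refine lt_of_le_of_ne (Nat.cast_nonneg _) fun h => ?_
  have := hx.2
  rw [normTrace, ← h] at this
  simp at this

theorem nontrivial_of_mem_domain (hx : x ∈ domain V) : Nontrivial V := by
  refine ⟨x, 0, fun h => ?_⟩
  have := hx.2
  rw [normTrace_eq, h, map_zero] at this
  simp at this

/-- The decomposition chosen in `power` does not depend on the exponent, so one frame serves all
`s`. -/
theorem power_eq (z : V) : ∃ (n : ℕ) (p : Fin n → V) (lam : Fin n → ℝ), IsJordanFrame p ∧
    z = ∑ i, lam i • p i ∧ ∀ s, power z s = ∑ i, lam i ^ s • p i := by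
  have h := nonempty_spectralDecomposition z
  exact ⟨h.some.n, h.some.p, h.some.lam, h.some.isJordanFrame, h.some.eq_sum, fun s => by
    rw [power, dif_pos h]⟩

/-- The path `t ↦ U (z ^ t)` for `U` the quadratic representation of a positive element,
written along Jordan frames. -/
theorem exists_sigmaPath_eq (hx : x ∈ interior (cone V)) (hy : y ∈ interior (cone V)) :
    ∃ (m n : ℕ) (p : Fin m → V) (a : Fin m → ℝ) (q : Fin n → V) (lam : Fin n → ℝ),
      IsJordanFrame p ∧ IsJordanFrame q ∧ (∀ i, 0 < a i) ∧ (∀ i, 0 < lam i) ∧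
      (∀ t, sigmaPath x y t = quadRep (∑ i, a i • p i) (∑ i, lam i ^ t • q i)) ∧
      x = quadRep (∑ i, a i • p i) (∑ i, (1 : ℝ) • q i) ∧
      y = quadRep (∑ i, a i • p i) (∑ i, lam i • q i) := by
  obtain ⟨m, p, b, hp, hxb, hpow⟩ := power_eq x
  have hb : ∀ i, 0 < b i := hp.sum_smul_mem_interior_iff.1 (hxb ▸ hx)
  set z := quadRep (power x (-(1 / 2))) y with hz
  have ha : ∀ i, 0 < b i ^ (1 / 2 : ℝ) := fun i => Real.rpow_pos_of_pos (hb i) _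
  have ha' : ∀ i, 0 < b i ^ (-(1 / 2) : ℝ) := fun i => Real.rpow_pos_of_pos (hb i) _
  have hzint : z ∈ interior (cone V) := by
    rw [hz, hpow]
    exact hp.quadRep_mem_interior ha' hy
  obtain ⟨n, q, lam, hq, hzq, hpowz⟩ := power_eq z
  have hlam : ∀ i, 0 < lam i := hq.sum_smul_mem_interior_iff.1 (hzq ▸ hzint)
  refine ⟨m, n, p, fun i => b i ^ (1 / 2 : ℝ), q, lam, hp, hq, ha, hlam, fun t => ?_, ?_, ?_⟩
  · rw [sigmaPath, hpow, ← hz, hpowz]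
  · simp only [one_smul]
    rw [hq.sum_eq_one, quadRep_one, hp.sum_mul_sum]
    conv_lhs => rw [hxb]
    refine Finset.sum_congr rfl fun i _ => ?_
    rw [← Real.rpow_add (hb i), add_halves, Real.rpow_one]
  · rw [← hzq, hz, hpow]
    have := hp.quadRep_inv_quadRep ha' y
    rw [← this]
    congr 1
    · refine Finset.sum_congr rfl fun i _ => ?_
      rw [Real.rpow_neg (hb i).le, inv_inv]
    · rw [this]

end Paths

/-! ### The normalized path has constant speed and minimal length -/

section Geodesic

variable {V : Type*} [EuclideanJordanAlgebra V]

theorem finslerNorm_quadRep {m : ℕ} {p : Fin m → V} (hp : IsJordanFrame p) {a : Fin m → ℝ}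
    (ha : ∀ i, 0 < a i) (w x : V) :
    finslerNorm (quadRep (∑ i, a i • p i) w) (quadRep (∑ i, a i • p i) x) = finslerNorm w x := by
  rw [finslerNorm, finslerNorm, hp.upperM_quadRep ha, hp.lowerM_quadRep ha]

theorem hasDerivAt_sum_rpow {n : ℕ} (q : Fin n → V) {lam : Fin n → ℝ} (hlam : ∀ i, 0 < lam i)
    (t : ℝ) : HasDerivAt (fun t : ℝ => ∑ i, lam i ^ t • q i)
      (∑ i, (Real.log (lam i) * lam i ^ t) • q i) t := by
  refine HasDerivAt.fun_sum fun i _ => ?_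
  have h := (Real.hasStrictDerivAt_const_rpow (hlam i) t).hasDerivAt
  rw [_root_.mul_comm]
  exact h.smul_const (q i)

theorem contDiff_sum_rpow {n : ℕ} (q : Fin n → V) {lam : Fin n → ℝ} (hlam : ∀ i, 0 < lam i) :
    ContDiff ℝ 1 (fun t : ℝ => ∑ i, lam i ^ t • q i) := by
  refine ContDiff.sum fun i _ => ContDiff.smul ?_ contDiff_const
  have h : (fun t : ℝ => lam i ^ t) = fun t => Real.exp (Real.log (lam i) * t) :=
    funext fun t => Real.rpow_def_of_pos (hlam i) t
  change ContDiff ℝ 1 (fun t : ℝ => lam i ^ t)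
  rw [h]
  fun_prop

theorem contDiff_quadRep (a : V) : ContDiff ℝ 1 (quadRep a) :=
  (LinearMap.toContinuousLinearMap (quadRepLin a)).contDiff

theorem hasDerivAt_quadRep (a : V) {τ : ℝ → V} {τ' : V} {t : ℝ} (h : HasDerivAt τ τ' t) :
    HasDerivAt (fun t => quadRep a (τ t)) (quadRep a τ') t :=
  (LinearMap.toContinuousLinearMap (quadRepLin a)).hasFDerivAt.comp_hasDerivAt t h

theorem contDiff_normTrace : ContDiff ℝ 1 (normTrace : V → ℝ) := by
  have : (normTrace : V → ℝ) = fun z => (1 / (rank V : ℝ)) * traceForm V z :=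
    funext normTrace_eq
  rw [this]
  exact contDiff_const.mul (LinearMap.toContinuousLinearMap (traceForm V)).contDiff

theorem normTrace_smul (c : ℝ) (z : V) : normTrace (c • z) = c * normTrace z := by
  rw [normTrace_eq, normTrace_eq, map_smul, smul_eq_mul]
  ring

theorem normTrace_pos {x z : V} (hx : x ∈ domain V) (hz : z ∈ interior (cone V)) :
    0 < normTrace z := by
  have := nontrivial_of_mem_domain hx
  rw [normTrace_eq]
  exact mul_pos (one_div_pos.2 (rank_pos_of_mem_domain hx)) (traceForm_pos hz)

theorem isPath_and_length_normalizedPath {x y : V} (hx : x ∈ domain V) (hy : y ∈ domain V) :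
    IsPath x y (normalizedPath x y) ∧ length (normalizedPath x y) = hilbertDist x y := by
  have hV := nontrivial_of_mem_domain hx
  obtain ⟨m, n, p, a, q, lam, hp, hq, ha, hlam, hσ, hxq, hyq⟩ := exists_sigmaPath_eq hx.1 hy.1
  set A := ∑ i, a i • p i
  have hpow : ∀ (t : ℝ) i, 0 < lam i ^ t := fun t i => Real.rpow_pos_of_pos (hlam i) t
  have hτint : ∀ t : ℝ, ∑ i, lam i ^ t • q i ∈ interior (cone V) := fun t =>
    hq.sum_smul_mem_interior_iff.2 (hpow t)
  have hσint : ∀ t, sigmaPath x y t ∈ interior (cone V) := fun t => by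
    rw [hσ]; exact hp.quadRep_mem_interior ha (hτint t)
  have hσ0 : sigmaPath x y 0 = x := by rw [hσ, hxq]; simp only [Real.rpow_zero]
  have hσ1 : sigmaPath x y 1 = y := by rw [hσ, hyq]; simp only [Real.rpow_one]
  have hσC : ContDiff ℝ 1 (sigmaPath x y) := by
    rw [show sigmaPath x y = fun t => _ from funext hσ]
    exact (contDiff_quadRep A).comp (contDiff_sum_rpow q hlam)
  have hφ : ∀ t, 0 < normTrace (sigmaPath x y t) := fun t => normTrace_pos hx (hσint t)
  have hgC : ContDiff ℝ 1 fun t => (normTrace (sigmaPath x y t))⁻¹ :=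
    (contDiff_normTrace.comp hσC).inv fun t => (hφ t).ne'
  have hμC : ContDiff ℝ 1 (normalizedPath x y) := hgC.smul hσC
  have hnorm : ∀ t, normalizedPath x y t ∈ domain V := fun t =>
    ⟨smul_mem_interior_cone (inv_pos.2 (hφ t)) (hσint t), by
      rw [normalizedPath, normTrace_smul, inv_mul_cancel₀ (hφ t).ne']⟩
  refine ⟨⟨?_, ?_, fun t _ => hnorm t, hμC.continuous.continuousOn, 1, fun i => (i : ℝ), by simp,
    by simp, fun i _ => by simp, fun i _ => hμC.contDiffOn⟩, ?_⟩
  · rw [normalizedPath, hσ0, hx.2, inv_one, one_smul]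
  · rw [normalizedPath, hσ1, hy.2, inv_one, one_smul]
  have hne : Nonempty (Fin n) := by
    by_contra h
    rw [not_nonempty_iff] at h
    have := hq.sum_eq_one
    rw [Finset.sum_of_isEmpty] at this
    exact one_ne_zero this.symm
  obtain ⟨i, hi⟩ := Finite.exists_max lam
  obtain ⟨j, hj⟩ := Finite.exists_min lam
  have hspeed : ∀ t, speed (normalizedPath x y) t = Real.log (lam i) - Real.log (lam j) := by
    intro t
    have hdσ : HasDerivAt (sigmaPath x y)
        (quadRep A (∑ i, (Real.log (lam i) * lam i ^ t) • q i)) t := by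
      rw [show sigmaPath x y = fun t => _ from funext hσ]
      exact hasDerivAt_quadRep A (hasDerivAt_sum_rpow q hlam t)
    have hdg := ((hgC.differentiable one_ne_zero) t).hasDerivAt
    have hdμ : HasDerivAt (normalizedPath x y) _ t := hdg.smul hdσ
    -- The product rule gives a multiple of `σ` plus the scaling factor times `σ'`. The seminorm
    -- ignores the former, and `U_A` drops out by invariance, which leaves diagonal elements with
    -- ratios `log (lam k)`.
    rw [speed, hdμ.deriv, normalizedPath, add_comm,
      finslerNorm_smul_add_smul (hσint t) (inv_pos.2 (hφ t)), hσ, finslerNorm_quadRep hp ha,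
      finslerNorm, hq.upperM_sum (hpow t) (j := i), hq.lowerM_sum (hpow t) (j := j)]
    · rw [mul_div_cancel_right₀ _ (hpow t i).ne', mul_div_cancel_right₀ _ (hpow t j).ne']
    · intro k
      rw [mul_div_cancel_right₀ _ (hpow t k).ne', mul_div_cancel_right₀ _ (hpow t j).ne']
      exact Real.log_le_log (hlam j) (hj k)
    · intro k
      rw [mul_div_cancel_right₀ _ (hpow t k).ne', mul_div_cancel_right₀ _ (hpow t i).ne']
      exact Real.log_le_log (hlam k) (hi k)
  have hM : upperM x y = 1 / lam j := by
    rw [hxq, hyq, hp.upperM_quadRep ha]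
    exact hq.upperM_sum hlam fun k => one_div_le_one_div_of_le (hlam j) (hj k)
  have hm : lowerM x y = 1 / lam i := by
    rw [hxq, hyq, hp.lowerM_quadRep ha]
    exact hq.lowerM_sum hlam fun k => one_div_le_one_div_of_le (hlam k) (hi k)
  rw [length, hilbertDist, hM, hm, one_div, one_div, inv_div_inv, Real.log_div (hlam i).ne' (hlam j).ne']
  simp [hspeed]

end Geodesic

end EuclideanJordanAlgebra

theorem mainTheorem7 {V : Type*} [EuclideanJordanAlgebra V] (x y : V)
    (hx : x ∈ EuclideanJordanAlgebra.domain V) (hy : y ∈ EuclideanJordanAlgebra.domain V) :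
    (∀ γ : ℝ → V, EuclideanJordanAlgebra.IsPath x y γ →
      IntervalIntegrable (EuclideanJordanAlgebra.speed γ) MeasureTheory.volume 0 1) ∧
    IsGLB {l : ℝ | ∃ γ : ℝ → V, EuclideanJordanAlgebra.IsPath x y γ ∧
        l = EuclideanJordanAlgebra.length γ}
      (EuclideanJordanAlgebra.hilbertDist x y) ∧
    EuclideanJordanAlgebra.IsPath x y (EuclideanJordanAlgebra.normalizedPath x y) ∧
    EuclideanJordanAlgebra.length (EuclideanJordanAlgebra.normalizedPath x y) =
      EuclideanJordanAlgebra.hilbertDist x y := by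
  have hV := EuclideanJordanAlgebra.nontrivial_of_mem_domain hx
  obtain ⟨hpath, hlen⟩ := EuclideanJordanAlgebra.isPath_and_length_normalizedPath hx hy
  refine ⟨fun γ hγ => hγ.intervalIntegrable_speed, ⟨?_, fun b hb => ?_⟩, hpath, hlen⟩
  · rintro l ⟨γ, hγ, rfl⟩
    exact hγ.hilbertDist_le_length
  · exact hlen ▸ hb ⟨_, hpath, rfl⟩
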